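/- Let $k$ be a field and let $K_0(\mathcal V)$ be the Grothendieck ring of varieties over $k$, with $\mathbb L=[\mathbb A^1]$ and $\mathbb T=[\mathbb G_m]=\mathbb L-1$. Graphs are finite multigraphs (loops and parallel edges are allowed, connectedness is not required). For a graph $\Gamma$ with edge set $E(\Gamma)$ and $n=\#E(\Gamma)$, let $$\Psi_\Gamma=\sum_{T}\ \prod_{\epsilon\in E(\Gamma)\smallsetminus T}t_\epsilon ,$$ where $T$ runs over the edge sets of the spanning forests of $\Gamma$ (the acyclic edge sets whose graph on all vertices of $\Gamma$ has the same connected components as $\Gamma$), let $\widehat X_\Gamma=\{\Psi_\Gamma=0\}\subset\mathbb A^n$, and put $\mathbb U(\Gamma)=[\mathbb A^n\smallsetminus\widehat X_\Gamma]\in K_0(\mathcal V)$. Let $e$ be an edge of $\Gamma$ with ends $a,b$ which is neither a bridge nor a looping edge. For $m\ge 0$ let $\Gamma^\Lambda_m$ be the "lemonade graph" obtained by building an $m$-lemon fanning out from $e$: add to $\Gamma$ new vertices $w_1,\dots,w_m$ and, with $w_0=b$, for each $0\le i<m$ a new edge joining $a$ to $w_{i+1}$ and a new edge joining $w_i$ to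 $w_{i+1}$ (so $\Gamma^\Lambda_0=\Gamma$, and $e$ is an end spoke of a fan of $m$ triangles with apex $a$; the labelling of the two ends of $e$ by $a$ and $b$ is arbitrary). Let $\Gamma\smallsetminus e$ and $\Gamma/e$ be the deletion and the contraction of $e$. Then in $K_0(\mathcal V)[[s]]$ the power series $1-\mathbb T(\mathbb T+1)s-\mathbb T(\mathbb T+1)^2s^2$ is invertible and $$\sum_{m\ge 0}\mathbb U(\Gamma^\Lambda_m)\,s^m=\frac{(1-(\mathbb T+1)s)\,\mathbb U(\Gamma)+(\mathbb T+1)\mathbb T s\,\mathbb U(\Gamma\smallsetminus e)+(\mathbb T+1)^2 s\,\mathbb U(\Gamma/e)}{1-\mathbb T(\mathbb T+1)s-\mathbb T(\mathbb T+1)^2s^2}.$$ -/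

import Mathlib

open CategoryTheory AlgebraicGeometry
open scoped Graph

universe u v

noncomputable section

/-! ### The Grothendieck ring of varieties -/

/-- A variety over the field `k`: a separated scheme of finite type over `k`. Non-reduced schemes
are allowed; since `X_red ⊆ X` is a closed subscheme with empty complement, `[X] = [X_red]` in the
Grothendieck ring, so this gives the usual ring. -/
structure AlgVariety (k : Type u) [Field k] where
  /-- the underlying scheme -/
  X : Scheme.{u}
  /-- the structure morphism -/
  hom : X ⟶ Spec (CommRingCat.of k)
  [locallyOfFiniteType : LocallyOfFiniteType hom]
  [quasiCompact : QuasiCompact hom]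
  [isSeparated : IsSeparated hom]

namespace AlgVariety

variable (k : Type u) [Field k]

/-- The point `Spec k`. -/
def point : AlgVariety k where
  X := Spec (CommRingCat.of k)
  hom := 𝟙 _

variable {k}

/-- The locus `{f ≠ 0}` as an open subset of the affine scheme `Spec A`. -/
def nonvanishing {A : Type u} [CommRing A] (f : A) : (Spec (CommRingCat.of A)).Opens :=
  PrimeSpectrum.basicOpen f

/-- The principal open subscheme `D(f) = {f ≠ 0}` of `Spec A`, for a `k`-algebra `A` of finite
type and `f : A`. -/
def principalOpen {A : Type u} [CommRing A] [Algebra k A] [Algebra.FiniteType k A] (f : A) :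
    AlgVariety k where
  X := (nonvanishing f).toScheme
  hom := (nonvanishing f).ι ≫ Spec.map (CommRingCat.ofHom (algebraMap k A))
  locallyOfFiniteType := by
    have : LocallyOfFiniteType (Spec.map (CommRingCat.ofHom (algebraMap k A))) := by
      rw [HasRingHomProperty.Spec_iff (P := @LocallyOfFiniteType)]
      exact (RingHom.finiteType_algebraMap).2 inferInstance
    infer_instance
  quasiCompact := by
    have : IsAffine (nonvanishing f).toScheme := IsAffineOpen.Spec_basicOpen (R := CommRingCat.of A) f
    infer_instance
  isSeparated := by
    infer_instance

end AlgVariety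

/-- The relations of the Grothendieck ring of varieties, as elements of the free commutative ring
on all varieties: isomorphism invariance, the scissor relation `[X] = [Z] + [X ∖ Z]` for a closed
subvariety `Z` of `X`, the product relation `[X ×ₖ Y] = [X] [Y]`, and `[Spec k] = 1`. -/
inductive GrothendieckRel (k : Type u) [Field k] : MvPolynomial (AlgVariety k) ℤ → Prop
  | iso (X Y : AlgVariety k) (f : X.X ≅ Y.X) (hf : f.hom ≫ Y.hom = X.hom) :
      GrothendieckRel k (MvPolynomial.X X - MvPolynomial.X Y)
  | scissor (X Z U : AlgVariety k) (i : Z.X ⟶ X.X) (j : U.X ⟶ X.X)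
      (hi : IsClosedImmersion i) (hj : IsOpenImmersion j)
      (hiX : i ≫ X.hom = Z.hom) (hjX : j ≫ X.hom = U.hom)
      (hij : Set.range j = (Set.range i)ᶜ) :
      GrothendieckRel k (MvPolynomial.X X - (MvPolynomial.X Z + MvPolynomial.X U))
  | prod (P X Y : AlgVariety k) (p : P.X ⟶ X.X) (q : P.X ⟶ Y.X)
      (h : IsPullback p q X.hom Y.hom) (hp : p ≫ X.hom = P.hom) :
      GrothendieckRel k (MvPolynomial.X P - MvPolynomial.X X * MvPolynomial.X Y)
  | one : GrothendieckRel k (MvPolynomial.X (AlgVariety.point k) - 1)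

/-- The Grothendieck ring `K₀(𝒱)` of varieties over `k`. -/
abbrev K0Var (k : Type u) [Field k] : Type (u + 1) :=
  MvPolynomial (AlgVariety k) ℤ ⧸ Ideal.span {p | GrothendieckRel k p}

/-- The class `[X] ∈ K₀(𝒱)` of a variety. -/
def AlgVariety.cls {k : Type u} [Field k] (X : AlgVariety k) : K0Var k :=
  Ideal.Quotient.mk _ (MvPolynomial.X X)

/-- `𝕋 = [𝔾ₘ] ∈ K₀(𝒱)`, where `𝔾ₘ = 𝔸¹ ∖ {0}`. -/
def torusClass (k : Type u) [Field k] : K0Var k :=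
  (AlgVariety.principalOpen (k := k) (Polynomial.X : Polynomial k)).cls

/-! ### Multigraphs -/

namespace Graph

variable {α : Type v} {β : Type u}

/-- `x` and `y` are joined by a path of `G`. -/
def Joined (G : Graph α β) (x y : α) : Prop := Relation.ReflTransGen G.Adj x y

/-- `e` is a bridge of `G`: an edge whose removal disconnects two vertices that are joined by a
path of `G` (so that the number of connected components increases). -/
def IsBridgeEdge (G : Graph α β) (e : β) : Prop :=
  e ∈ E(G) ∧ ∃ x y, G.Joined x y ∧ ¬ (G.deleteEdges {e}).Joined x y

/-- `e` is a looping edge of `G`. -/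
def IsLoopingEdge (G : Graph α β) (e : β) : Prop := ∃ x, G.IsLoopAt e x

/-- `T` is the edge set of a spanning forest of `G` (a spanning tree in each connected component):
the subgraph with all vertices of `G` and edge set `T` has no cycles (i.e. all its edges are
bridges) and has the same connected components as `G`. -/
def IsSpanningForest (G : Graph α β) (T : Set β) : Prop :=
  T ⊆ E(G) ∧ (∀ e ∈ T, (G.restrict T).IsBridgeEdge e) ∧
    ∀ x y, G.Joined x y → (G.restrict T).Joined x y

open Classical in
/-- The Kirchhoff polynomial `Ψ_G = ∑_T ∏_{e ∉ T} t_e`, the sum over all spanning forests `T`. -/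
def kirchhoff (k : Type u) [Field k] (G : Graph α β) [Finite E(G)] : MvPolynomial E(G) k :=
  letI := Fintype.ofFinite E(G)
  ∑ T ∈ Finset.univ.filter
      (fun T : Finset E(G) => G.IsSpanningForest (Subtype.val '' (T : Set E(G)))),
    ∏ e ∈ Tᶜ, MvPolynomial.X e

/-- `𝕌(G) = [𝔸ⁿ ∖ X̂_G] ∈ K₀(𝒱)`, where `n` is the number of edges of `G` and `X̂_G` is the affine
hypersurface `Ψ_G = 0`. -/
def motivicU (k : Type u) [Field k] (G : Graph α β) [Finite E(G)] : K0Var k :=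
  (AlgVariety.principalOpen (k := k) (G.kirchhoff k)).cls

/-- The contraction `G / e`: the edge `e` is removed and its ends are identified. -/
def contractEdge (G : Graph α β) (e : β) : Graph (Quot (G.IsLink e)) β :=
  (G.deleteEdges {e}).map (Quot.mk (G.IsLink e))

/-- The rim vertices `b = w₀, w₁, w₂, …` of the lemon; `w_{i+1}` is the new vertex `i`. -/
def rimVertex (b : α) : ℕ → α ⊕ ℕ
  | 0 => Sum.inl b
  | i + 1 => Sum.inr i

/-- The ends of the new edges of the lemon with apex `a` built on an edge from `a` to `b`:
`(i, true)` is the spoke from `a` to `w_{i+1}`, and `(i, false)` is the rim edge from `w_i` to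
`w_{i+1}`. -/
def lemonEnds (a b : α) : ℕ × Bool → Sym2 (α ⊕ ℕ)
  | (i, true) => s(Sum.inl a, rimVertex b (i + 1))
  | (i, false) => s(rimVertex b i, rimVertex b (i + 1))

/-- The lemonade graph obtained from `G` by building an `m`-lemon fanning out from the edge `e`
with ends `a` and `b`: one adds `m` new vertices `w₁, …, w_m`, and for `0 ≤ i < m` the edges
`a w_{i+1}` and `w_i w_{i+1}`, where `w₀ = b`. Thus `e` becomes an end spoke of a fan of `m`
triangles `a w_i w_{i+1}` with apex `a`. -/
def lemonade (G : Graph α β) {e : β} {a b : α} (he : G.IsLink e a b) (m : ℕ) :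
    Graph (α ⊕ ℕ) (β ⊕ ℕ × Bool) where
  vertexSet := Sum.inl '' V(G) ∪ Sum.inr '' {i | i < m}
  edgeSet := Sum.inl '' E(G) ∪ Sum.inr '' {p | p.1 < m}
  IsLink f x y := match f with
    | Sum.inl f => ∃ u v, G.IsLink f u v ∧ x = Sum.inl u ∧ y = Sum.inl v
    | Sum.inr p => p.1 < m ∧ s(x, y) = lemonEnds a b p
  isLink_symm := by
    rintro (f | p) -
    · exact ⟨fun x y ⟨u, v, h, hx, hy⟩ => ⟨v, u, h.symm, hy, hx⟩⟩
    · exact ⟨fun x y ⟨h, hxy⟩ => ⟨h, Sym2.eq_swap.trans hxy⟩⟩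
  eq_or_eq_of_isLink_of_isLink := by
    rintro (f | p) x y v w
    · rintro ⟨x, y, h, rfl, rfl⟩ ⟨v, w, h', rfl, rfl⟩
      simpa using G.eq_or_eq_of_isLink_of_isLink h h'
    · rintro ⟨-, h⟩ ⟨-, h'⟩
      rcases Sym2.eq_iff.1 (h.trans h'.symm) with h | h
      · exact Or.inl h.1
      · exact Or.inr h.1
  edge_mem_iff_exists_isLink := by
    rintro (f | p)
    · simp only [Set.mem_union, Set.mem_image, Sum.inl.injEq, exists_eq_right, reduceCtorEq,
        and_false, exists_false, or_false]
      constructor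
      · intro hf
        obtain ⟨u, v, h⟩ := (G.edge_mem_iff_exists_isLink f).1 hf
        exact ⟨_, _, u, v, h, rfl, rfl⟩
      · rintro ⟨_, _, u, v, h, -, -⟩
        exact (G.edge_mem_iff_exists_isLink f).2 ⟨u, v, h⟩
    · simp only [Set.mem_union, Set.mem_image, Sum.inr.injEq, exists_eq_right, reduceCtorEq,
        and_false, exists_false, false_or, Set.mem_ofPred_eq, exists_and_left, iff_self_and]
      intro _
      induction lemonEnds a b p using Sym2.ind with
      | _ x y => exact ⟨x, y, rfl⟩
  left_mem_of_isLink := by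
    have hr : ∀ i, i ≤ m → rimVertex b i ∈ (Sum.inl '' V(G) ∪ Sum.inr '' {i | i < m} :
        Set (α ⊕ ℕ)) := by
      rintro (_ | i) hi
      · exact Or.inl ⟨b, he.symm.left_mem, rfl⟩
      · exact Or.inr ⟨i, hi, rfl⟩
    have ha : (Sum.inl a : α ⊕ ℕ) ∈ (Sum.inl '' V(G) ∪ Sum.inr '' {i | i < m} :
        Set (α ⊕ ℕ)) := Or.inl ⟨a, he.left_mem, rfl⟩
    rintro (f | ⟨i, _ | _⟩) x y
    · rintro ⟨u, v, h, rfl, rfl⟩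
      exact Or.inl ⟨u, h.left_mem, rfl⟩
    · rintro ⟨hi : i < m, h⟩
      rcases Sym2.eq_iff.1 h with h | h <;> rw [h.1]
      · exact hr _ hi.le
      · exact hr _ hi
    · rintro ⟨hi : i < m, h⟩
      rcases Sym2.eq_iff.1 h with h | h <;> rw [h.1]
      · exact ha
      · exact hr _ hi

instance finite_edgeSet_deleteEdges (G : Graph α β) [Finite E(G)] (F : Set β) :
    Finite E(G.deleteEdges F) :=
  (Set.toFinite E(G)).subset (by simp)

instance finite_edgeSet_contractEdge (G : Graph α β) [Finite E(G)] (e : β) :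
    Finite E(G.contractEdge e) :=
  finite_edgeSet_deleteEdges G {e}

instance finite_edgeSet_lemonade (G : Graph α β) [Finite E(G)] {e : β} {a b : α}
    (he : G.IsLink e a b) (m : ℕ) : Finite E(G.lemonade he m) :=
  ((Set.toFinite E(G)).image _).union
    ((((Set.finite_lt_nat m).prod (Set.finite_univ (α := Bool))).subset
      fun _ hp => ⟨hp, trivial⟩).image _)

end Graph

end

/-! ### Classes of affine varieties -/

namespace AlgVariety

variable {k : Type u} [Field k]

/-! Write `F` and `G` for the Kirchhoff polynomials of `Γ ∖ e` and `Γ / e`. Since `e` is neither a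
bridge nor a loop, `Ψ_Γ = F t_e + G`. A triangle built on `e` with new edges `p`, `q` has the
spanning forests `T ∪ {p}` and `T ∪ {q}` for `T` a forest of `Γ`, and `(T ∖ {e}) ∪ {p, q}` for `T`
containing `e`. Its polynomial is therefore `(t_p + t_q) Ψ_Γ + t_e G`. In the coordinate `t = t_p +
t_q` one variable becomes free, which gives a factor `𝕃 = 𝕋 + 1` (`basisCls_addTriangle`). What
remains is `t Ψ_Γ + t_e G`, the polynomial of `Γ` with `e` doubled. Its class is `(𝕋 - 1) 𝕌(Γ) + 𝕋
𝕌(Γ ∖ e) + 𝕃 𝕌(Γ / e)` by `openCls_parallel`, which rests on the class of the complement of `{p x +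
q = 0}` (`openCls_C_mul_X_add_C`). This determines `𝕌(Γ^Λ_1)`. The next triangle stands on the spoke
`p`. There the deletion has class `𝕃` times the class before the triangle, and the contraction is
the doubled-edge polynomial again, so the formula closes up into `u_{m+2} = 𝕃𝕋 u_{m+1} + 𝕋𝕃² u_m`
(`basisCls_addTriangle_addTriangle`). The generating series is read off from this recursion and its
two initial values. -/

theorem cls_eq_of_iso {X Y : AlgVariety k} (f : X.X ≅ Y.X) (hf : f.hom ≫ Y.hom = X.hom) :
    X.cls = Y.cls :=
  Ideal.Quotient.eq.2 (Ideal.subset_span (GrothendieckRel.iso X Y f hf))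

theorem cls_scissor {X Z U : AlgVariety k} (i : Z.X ⟶ X.X) (j : U.X ⟶ X.X)
    [hi : IsClosedImmersion i] [hj : IsOpenImmersion j]
    (hiX : i ≫ X.hom = Z.hom) (hjX : j ≫ X.hom = U.hom)
    (hij : Set.range j = (Set.range i)ᶜ) : X.cls = Z.cls + U.cls := by
  have h := Ideal.Quotient.eq.2 (Ideal.subset_span (GrothendieckRel.scissor X Z U i j hi hj hiX hjX hij))
  rwa [map_add] at h

theorem cls_prod {P X Y : AlgVariety k} (p : P.X ⟶ X.X) (q : P.X ⟶ Y.X)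
    (h : IsPullback p q X.hom Y.hom) (hp : p ≫ X.hom = P.hom) : P.cls = X.cls * Y.cls := by
  have h := Ideal.Quotient.eq.2 (Ideal.subset_span (GrothendieckRel.prod P X Y p q h hp))
  rwa [map_mul] at h

variable (k) in
theorem cls_point : (point k).cls = 1 := by
  have h := Ideal.Quotient.eq.2 (Ideal.subset_span (GrothendieckRel.one (k := k)))
  rwa [map_one] at h

variable (k) in
/-- The affine variety `Spec A`. -/
noncomputable def affine (A : Type u) [CommRing A] [Algebra k A] [Algebra.FiniteType k A] :
    AlgVariety k where
  X := Spec (CommRingCat.of A)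
  hom := Spec.map (CommRingCat.ofHom (algebraMap k A))
  locallyOfFiniteType := by
    rw [HasRingHomProperty.Spec_iff (P := @LocallyOfFiniteType)]
    exact (RingHom.finiteType_algebraMap).2 inferInstance

theorem cls_affine_self : (affine k k).cls = 1 := by
  rw [← cls_point k]
  refine cls_eq_of_iso (Iso.refl _) ?_
  simp [affine, point]

theorem cls_affine_congr {A B : Type u} [CommRing A] [Algebra k A] [Algebra.FiniteType k A]
    [CommRing B] [Algebra k B] [Algebra.FiniteType k B] (φ : A ≃ₐ[k] B) :
    (affine k A).cls = (affine k B).cls := by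
  refine cls_eq_of_iso (Scheme.Spec.mapIso φ.toRingEquiv.toCommRingCatIso.symm.op) ?_
  simp only [affine, Functor.mapIso_hom, Scheme.Spec_map, Iso.op_hom, Iso.symm_hom]
  refine (Spec.map_comp _ _).symm.trans ?_
  congr 1
  ext x
  exact φ.symm.commutes x

theorem cls_affine_tensorProduct (A B : Type u) [CommRing A] [Algebra k A] [Algebra.FiniteType k A]
    [CommRing B] [Algebra k B] [Algebra.FiniteType k B]
    [Algebra.FiniteType k (TensorProduct k A B)] :
    (affine k (TensorProduct k A B)).cls = (affine k A).cls * (affine k B).cls := by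
  refine cls_prod _ _ (isPullback_SpecMap_of_isPushout _ _ _ _
    (CommRingCat.isPushout_tensorProduct k A B)) ?_
  exact (Spec.map_comp _ _).symm

/-- A localization away from `f` computes the class of `D(f)`. -/
theorem cls_principalOpen_eq_affine {A S : Type u} [CommRing A] [Algebra k A]
    [Algebra.FiniteType k A] [CommRing S] [Algebra k S] [Algebra.FiniteType k S] [Algebra A S]
    [IsScalarTower k A S] (f : A) [IsLocalization.Away f S] :
    (principalOpen (k := k) f).cls = (affine k S).cls := by
  have : IsOpenImmersion (Spec.map (CommRingCat.ofHom (algebraMap A S))) :=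
    IsOpenImmersion.of_isLocalization f
  have hr : Set.range (Spec.map (CommRingCat.ofHom (algebraMap A S))) =
      Set.range (nonvanishing f).ι := by
    rw [Scheme.Opens.range_ι]
    exact PrimeSpectrum.localization_away_comap_range S f
  let ι := IsOpenImmersion.isoOfRangeEq _ _ hr
  have hι : ι.hom ≫ (nonvanishing f).ι = Spec.map (CommRingCat.ofHom (algebraMap A S)) :=
    IsOpenImmersion.isoOfRangeEq_hom_fac _ _ hr
  symm
  refine cls_eq_of_iso (X := affine k S) (Y := principalOpen f) ι ?_
  simp only [principalOpen, affine, ← Category.assoc, hι]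
  rw [← Spec.map_comp, ← CommRingCat.ofHom_comp, ← IsScalarTower.algebraMap_eq]

/-- The scissor relation for the closed subscheme `{g = 0}` of `D(f)`. -/
theorem cls_principalOpen_scissor {A B : Type u} [CommRing A] [Algebra k A]
    [Algebra.FiniteType k A] [CommRing B] [Algebra k B] [Algebra.FiniteType k B] (φ : A →ₐ[k] B)
    (hφ : Function.Surjective φ) (f g : A) (hg : RingHom.ker φ = Ideal.span {g}) :
    (principalOpen (k := k) f).cls =
      (principalOpen (k := k) (φ f)).cls + (principalOpen (k := k) (f * g)).cls := by
  let s : Spec (CommRingCat.of B) ⟶ Spec (CommRingCat.of A) :=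
    Spec.map (CommRingCat.ofHom φ.toRingHom)
  have hs : IsClosedImmersion s := IsClosedImmersion.spec_of_surjective _ hφ
  have hle : nonvanishing (f * g) ≤ nonvanishing f := by
    intro x hx
    exact PrimeSpectrum.basicOpen_mul_le_left f g hx
  -- The preimage of `D(f)` under `s` is `D(φ f)` by definition, so the restriction of `s` has the
  -- required source.
  let i : (nonvanishing (φ f)).toScheme ⟶ (nonvanishing f).toScheme := s ∣_ (nonvanishing f)
  have hi : IsClosedImmersion i :=
    inferInstanceAs (IsClosedImmersion (s ∣_ (nonvanishing f)))
  have hiι : i ≫ (nonvanishing f).ι = (nonvanishing (φ f)).ι ≫ s := morphismRestrict_ι s _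
  let j := (Spec (CommRingCat.of A)).homOfLE hle
  have hjι : j ≫ (nonvanishing f).ι = (nonvanishing (f * g)).ι := Scheme.homOfLE_ι _ hle
  have hinj : Function.Injective (nonvanishing f).ι := (nonvanishing f).ι.isOpenEmbedding.injective
  have hrj : Set.range j = {x | g ∉ ((nonvanishing f).ι x).asIdeal} := by
    ext x
    constructor
    · rintro ⟨y, rfl⟩
      have h1 : (nonvanishing f).ι (j y) = (nonvanishing (f * g)).ι y := by
        rw [← hjι]; rfl
      have h2 : (nonvanishing (f * g)).ι y ∈ nonvanishing (f * g) := y.2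
      rw [← h1] at h2
      exact PrimeSpectrum.basicOpen_mul_le_right f g h2
    · intro hx
      have hf : (nonvanishing f).ι x ∈ nonvanishing f := x.2
      have hfg : (nonvanishing f).ι x ∈ nonvanishing (f * g) :=
        (PrimeSpectrum.basicOpen_mul f g).ge ⟨hf, hx⟩
      refine ⟨⟨_, hfg⟩, hinj ?_⟩
      have h1 : (nonvanishing f).ι (j ⟨_, hfg⟩) = (nonvanishing (f * g)).ι ⟨_, hfg⟩ := by
        rw [← hjι]; rfl
      exact h1
  have hri : Set.range i = {x | g ∈ ((nonvanishing f).ι x).asIdeal} := by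
    have hrs : Set.range s = PrimeSpectrum.zeroLocus {g} := by
      have := range_comap_of_surjective _ φ.toRingHom hφ
      refine this.trans ?_
      rw [← PrimeSpectrum.zeroLocus_span {g}, ← hg]
      rfl
    ext x
    constructor
    · rintro ⟨y, rfl⟩
      have h1 : (nonvanishing f).ι (i y) = s ((nonvanishing (φ f)).ι y) := by
        have := congr($hiι y)
        exact this
      have h2 : s ((nonvanishing (φ f)).ι y) ∈ Set.range s := ⟨_, rfl⟩
      rw [hrs, ← h1] at h2
      exact (Set.singleton_subset_iff (s := (((nonvanishing f).ι (i y)).asIdeal : Set A))).1 h2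
    · intro hx
      have h2 : (nonvanishing f).ι x ∈ Set.range s := by
        rw [hrs]
        exact (Set.singleton_subset_iff (s := (((nonvanishing f).ι x).asIdeal : Set A))).2 hx
      obtain ⟨y, hy⟩ := h2
      have hf : (nonvanishing f).ι x ∈ nonvanishing f := x.2
      rw [← hy] at hf
      have hy' : y ∈ nonvanishing (φ f) := hf
      refine ⟨⟨y, hy'⟩, hinj ?_⟩
      have h1 : (nonvanishing f).ι (i ⟨y, hy'⟩) = s ((nonvanishing (φ f)).ι ⟨y, hy'⟩) := by
        have := congr($hiι ⟨y, hy'⟩)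
        exact this
      exact h1.trans hy
  refine cls_scissor (X := principalOpen f) (Z := principalOpen (φ f))
    (U := principalOpen (f * g)) (hi := hi)
    (hj := inferInstanceAs (IsOpenImmersion ((Spec (CommRingCat.of A)).homOfLE hle))) i j ?_ ?_ ?_
  · simp only [principalOpen, ← Category.assoc, hiι]
    rw [Category.assoc]
    congr 1
    refine (Spec.map_comp _ _).symm.trans ?_
    congr 1
    ext x
    exact φ.commutes x
  · simp only [principalOpen, ← Category.assoc, hjι]
  · refine hrj.trans ?_
    change _ = (Set.range i)ᶜ
    rw [hri]
    rfl

end AlgVariety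

/-! ### Calculus of classes of principal opens in affine schemes and affine lines over them. -/

namespace MotivicClass

open Polynomial
open AlgVariety hiding X

section Calculus

variable {k : Type u} [Field k] {A B : Type u} [CommRing A] [Algebra k A] [Algebra.FiniteType k A]
  [CommRing B] [Algebra k B] [Algebra.FiniteType k B]

variable (k) in
/-- The class of `D(f) ⊆ Spec A` in the Grothendieck ring of varieties. -/
noncomputable def openCls (f : A) : K0Var k := (principalOpen (k := k) f).cls

theorem openCls_scissor (φ : A →ₐ[k] B) (hφ : Function.Surjective φ) (f g : A)
    (hg : RingHom.ker φ = Ideal.span {g}) :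
    openCls k f = openCls k (φ f) + openCls k (f * g) :=
  cls_principalOpen_scissor φ hφ f g hg

-- The scissor relation for the identity with `f = g = 0` reads `c = c + c`.
@[simp]
theorem openCls_zero : openCls k (0 : A) = 0 := by
  have h := openCls_scissor (AlgHom.id k A) Function.surjective_id 0 0 (by
    ext x
    simp [RingHom.mem_ker])
  simpa using h

theorem openCls_map (φ : A ≃ₐ[k] B) (f : A) : openCls k (φ f) = openCls k f := by
  have h := openCls_scissor (φ : A →ₐ[k] B) φ.surjective f 0 (by
    ext x
    simp [RingHom.mem_ker])
  simpa using h.symm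

theorem openCls_quotient (f g : A) :
    openCls k (Ideal.Quotient.mk (Ideal.span {g}) f) = openCls k f - openCls k (f * g) := by
  rw [eq_sub_iff_add_eq]
  exact (openCls_scissor (Ideal.Quotient.mkₐ k (Ideal.span {g}))
    (Ideal.Quotient.mkₐ_surjective k _) f g (Ideal.Quotient.mkₐ_ker k _)).symm

/-- On `{g = 0}` the function `f` vanishes, so that stratum of `D(f)` contributes nothing. -/
theorem openCls_mul_of_dvd {f g : A} (h : g ∣ f) : openCls k (f * g) = openCls k f := by
  have h' := openCls_quotient (k := k) f g
  rw [Ideal.Quotient.eq_zero_iff_mem.2 (Ideal.mem_span_singleton.2 h), openCls_zero] at h'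
  exact (sub_eq_zero.1 h'.symm).symm

theorem openCls_eq_affine (f : A) (S : Type u) [CommRing S] [Algebra k S] [Algebra.FiniteType k S]
    [Algebra A S] [IsScalarTower k A S] [IsLocalization.Away f S] :
    openCls k f = (affine k S).cls :=
  cls_principalOpen_eq_affine f

variable (k) in
theorem openCls_one (A : Type u) [CommRing A] [Algebra k A] [Algebra.FiniteType k A] :
    openCls k (1 : A) = (affine k A).cls := by
  have : IsLocalization.Away (1 : A) A := IsLocalization.away_of_isUnit_of_bijective A isUnit_one
    Function.bijective_id
  exact openCls_eq_affine 1 A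

variable (k) in
theorem finiteType_of_isLocalization_away (f : A) (S : Type u) [CommRing S] [Algebra k S]
    [Algebra A S] [IsScalarTower k A S] [IsLocalization.Away f S] : Algebra.FiniteType k S :=
  have : Algebra.FiniteType A S := IsLocalization.finiteType_of_monoid_fg (Submonoid.powers f) S
  Algebra.FiniteType.trans (S := A) inferInstance this

theorem openCls_mul_eq (f g : A) (S : Type u) [CommRing S] [Algebra k S] [Algebra.FiniteType k S]
    [Algebra A S] [IsScalarTower k A S] [IsLocalization.Away f S] :
    openCls k (f * g) = openCls k (algebraMap A S g) := by
  let T := Localization.Away (algebraMap A S g)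
  have : Algebra.FiniteType k T := finiteType_of_isLocalization_away k (algebraMap A S g) T
  have : IsLocalization.Away (f * g) T := IsLocalization.Away.mul' S T f g
  rw [openCls_eq_affine (f * g) T, openCls_eq_affine (algebraMap A S g) T]

variable (k) in
/-- The class `𝕃` of the affine line. -/
noncomputable def lineClass : K0Var k := (affine k k[X]).cls

theorem cls_affine_polynomial : (affine k A[X]).cls = lineClass k * (affine k A).cls := by
  have : Algebra.FiniteType k (TensorProduct k A k[X]) :=
    Algebra.FiniteType.equiv inferInstance (polyEquivTensor k A)
  rw [cls_affine_congr (polyEquivTensor k A), cls_affine_tensorProduct, mul_comm]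
  rfl

/-- The zero section is cut out of the affine line over `Spec A`. -/
theorem openCls_X_add : openCls k (X : A[X]) + (affine k A).cls = lineClass k * (affine k A).cls := by
  have h := openCls_scissor ((aeval (0 : A)).restrictScalars k : A[X] →ₐ[k] A)
    (fun a => ⟨C a, by simp⟩) 1 X (by
      ext p
      rw [RingHom.mem_ker, Ideal.mem_span_singleton, X_dvd_iff, coeff_zero_eq_eval_zero]
      simp)
  rw [map_one, one_mul, openCls_one, openCls_one, cls_affine_polynomial] at h
  rw [h, add_comm]

variable (k) in
theorem lineClass_eq : lineClass k = torusClass k + 1 := by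
  have h := openCls_X_add (k := k) (A := k)
  rw [cls_affine_self, mul_one] at h
  exact h.symm

theorem openCls_X : openCls k (X : A[X]) = torusClass k * (affine k A).cls := by
  have h := openCls_X_add (k := k) (A := A)
  rw [lineClass_eq] at h
  linear_combination h

attribute [local instance] Polynomial.algebra in
theorem openCls_C_mul (p : A) (h : A[X]) (S : Type u) [CommRing S] [Algebra k S]
    [Algebra.FiniteType k S] [Algebra A S] [IsScalarTower k A S] [IsLocalization.Away p S] :
    openCls k (C p * h) = openCls k (h.map (algebraMap A S)) := by
  have : IsLocalization.Away (C p) S[X] := by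
    have := Polynomial.isLocalization (Submonoid.powers p) S
    rwa [Submonoid.map_powers] at this
  have : IsScalarTower k A[X] S[X] := .of_algebraMap_eq fun x => by
    simp [Polynomial.algebraMap_def, Polynomial.algebraMap_apply, IsScalarTower.algebraMap_apply k A S]
  rw [openCls_mul_eq (C p) h S[X]]
  rfl

theorem openCls_C (p : A) : openCls k (C p) = lineClass k * openCls k p := by
  let S := Localization.Away p
  have : Algebra.FiniteType k S := finiteType_of_isLocalization_away k p S
  have h := openCls_C_mul (k := k) p 1 S
  rwa [mul_one, Polynomial.map_one, openCls_one, cls_affine_polynomial,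
    ← openCls_eq_affine p S] at h

theorem openCls_C_mul_X (p : A) : openCls k (C p * X) = torusClass k * openCls k p := by
  let S := Localization.Away p
  have : Algebra.FiniteType k S := finiteType_of_isLocalization_away k p S
  rw [openCls_C_mul (k := k) p X S, Polynomial.map_X, openCls_X, ← openCls_eq_affine p S]

/-- Over `D(p)` the element `p x + q` is itself a coordinate of the line, so its nonvanishing locus
is a copy of `𝔾ₘ × D(p)`. -/
theorem openCls_C_mul_C_mul_X_add_C (p q : A) :
    openCls k (C p * (C p * X + C q)) = torusClass k * openCls k p := by
  let S := Localization.Away p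
  have : Algebra.FiniteType k S := finiteType_of_isLocalization_away k p S
  have hp : IsUnit (algebraMap A S p) := IsLocalization.Away.algebraMap_isUnit p
  let := hp.invertible
  have h := openCls_map ((algEquivCMulXAddC (algebraMap A S p)
    (algebraMap A S q)).restrictScalars k) (X : S[X])
  rw [openCls_X, ← openCls_eq_affine p S] at h
  rw [openCls_C_mul (k := k) p _ S, ← h]
  congr 1
  simp

/-- The complement of `{p x + q = 0}` in the affine line over `Spec A`. -/
theorem openCls_C_mul_X_add_C (p q : A) :
    openCls k (C p * X + C q : A[X]) =
      torusClass k * openCls k p + lineClass k * (openCls k q - openCls k (p * q)) := by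
  -- Stratification by `p`: on `{p = 0}` the function is the constant `q`, on `D(p)` it is a
  -- coordinate.
  have h2 := openCls_scissor (Polynomial.mapAlgHom (Ideal.Quotient.mkₐ k (Ideal.span {p})))
    (Polynomial.map_surjective _ Ideal.Quotient.mk_surjective) (C p * X + C q) (C p) (by
      ext f
      have := Ideal.mem_map_C_iff (I := Ideal.span {p}) (f := f)
      rw [Ideal.map_span, Set.image_singleton] at this
      rw [this, RingHom.mem_ker]
      simp [Polynomial.ext_iff, Ideal.Quotient.eq_zero_iff_mem])
  have h3 : (Polynomial.mapAlgHom (Ideal.Quotient.mkₐ k (Ideal.span {p}))) (C p * X + C q) =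
      C (Ideal.Quotient.mk (Ideal.span {p}) q) := by
    simp
  rw [h3, openCls_C, openCls_quotient, mul_comm _ (C p), openCls_C_mul_C_mul_X_add_C] at h2
  rw [h2, mul_comm q]
  ring

/-- The class of the complement of the hypersurface obtained by doubling a variable. -/
theorem openCls_parallel (F G : A) :
    openCls k (C (C F * X + C G) * X + C (C G * X) : A[X][X]) =
      (torusClass k - 1) * openCls k (C F * X + C G : A[X]) + torusClass k * openCls k F
        + lineClass k * openCls k G := by
  have hU := openCls_C_mul_X_add_C (k := k) F G
  have hD := openCls_C_mul_X_add_C (k := k) (C F * X + C G) (C G * X)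
  rw [openCls_C_mul_X] at hD
  -- With `U = F x + G`, the linear formula `hD` leaves the class of `U G x` to be found. It lives
  -- over `D(G)`: there `[U x]` is `[U]` minus the slice `x = 0`, where `U = G` is invertible, and
  -- `h4` gives `[U]`. The result is `𝕋[G] - [F G]`, and `hU` eliminates `[F G]`.
  let S := Localization.Away G
  have : Algebra.FiniteType k S := finiteType_of_isLocalization_away k G S
  have h1 := openCls_C_mul (k := k) G ((C F * X + C G) * X) S
  have h2 := openCls_scissor ((aeval (0 : S)).restrictScalars k : S[X] →ₐ[k] S)
    (fun a => ⟨C a, by simp⟩) ((C F * X + C G).map (algebraMap A S)) X (by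
      ext p
      rw [RingHom.mem_ker, Ideal.mem_span_singleton, X_dvd_iff, coeff_zero_eq_eval_zero]
      simp)
  have h3 : ((aeval (0 : S)).restrictScalars k : S[X] →ₐ[k] S)
      ((C F * X + C G).map (algebraMap A S)) = algebraMap A S G := by
    simp
  have h4 := openCls_C_mul_X_add_C (k := k) (algebraMap A S F) (algebraMap A S G)
  rw [← map_mul, ← openCls_mul_eq G G S, ← openCls_mul_eq G (F * G) S, ← openCls_mul_eq G F S,
    openCls_mul_of_dvd dvd_rfl, mul_comm G (F * G), openCls_mul_of_dvd (dvd_mul_left G F),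
    mul_comm G F] at h4
  rw [h3, ← openCls_mul_eq G G S, openCls_mul_of_dvd dvd_rfl] at h2
  rw [Polynomial.map_mul, map_X] at h1
  have h5 : (C F * X + C G : A[X]) * (C G * X) = C G * ((C F * X + C G) * X) := by ring
  have h6 : (C F * X + C G : A[X]).map (algebraMap A S) =
      C (algebraMap A S F) * X + C (algebraMap A S G) := by simp
  rw [h5, h1] at hD
  rw [h6] at h2 hD
  rw [lineClass_eq] at *
  linear_combination hD + (torusClass k + 1) * h2 - (torusClass k + 1) * h4 + hU

end Calculus

end MotivicClass

/-! ### Basis generating polynomials -/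

open Classical in
/-- The sum, over all subsets `T` of `E` with `B T`, of the product of the variables outside `T`. -/
noncomputable def basisPoly (k : Type u) [Field k] {E : Type u} [Finite E] (B : Set E → Prop) :
    MvPolynomial E k :=
  letI := Fintype.ofFinite E
  ∑ T ∈ Finset.univ.filter (fun T : Finset E => B (T : Set E)), ∏ e ∈ Tᶜ, MvPolynomial.X e

namespace basisPoly

section Sets

variable {E : Type*}

/-- The sets containing the last element, with that element removed. -/
def link (B : Set (Option E) → Prop) (T : Set E) : Prop := B (insert none (some '' T))

/-- The sets avoiding the last element. -/
def deletion (B : Set (Option E) → Prop) (T : Set E) : Prop := B (some '' T)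

/-- The spanning forests after a triangle has been built on the last edge: the new spoke is `none`,
the new rim edge is `some none`. -/
def addTriangle (B : Set (Option E) → Prop) (T : Set (Option (Option (Option E)))) : Prop :=
  (Xor (none ∈ T) (some none ∈ T) ∧ B ((fun x => some (some x)) ⁻¹' T)) ∨
    (none ∈ T ∧ some none ∈ T ∧ some (some none) ∉ T ∧
      B (insert none ((fun x => some (some x)) ⁻¹' T)))

theorem not_deletion_deletion_addTriangle (B : Set (Option E) → Prop) (T : Set (Option E)) :
    ¬ deletion (deletion (addTriangle B)) T := by
  simp [deletion, addTriangle, Xor]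

theorem link_deletion_addTriangle (B : Set (Option E) → Prop) (T : Set (Option E)) :
    link (deletion (addTriangle B)) T ↔ B T := by
  have : (fun x => some (some x)) ⁻¹' (some '' insert none (some '' T)) = T := by
    ext x; simp
  simp [link, deletion, addTriangle, Xor, this]

theorem deletion_link_addTriangle (B : Set (Option E) → Prop) (T : Set (Option E)) :
    deletion (link (addTriangle B)) T ↔ B T := by
  have : (fun x => some (some x)) ⁻¹' (insert none (some '' (some '' T))) = T := by
    ext x; simp
  simp [link, deletion, addTriangle, Xor, this]

/-- Here `none` is the old edge `e`: with both new edges present, they replace `e` in a forest. -/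
theorem link_link_addTriangle (B : Set (Option E) → Prop) (T : Set (Option E)) :
    link (link (addTriangle B)) T ↔ none ∉ T ∧ B (insert none T) := by
  have : (fun x => some (some x)) ⁻¹' (insert none (some '' (insert none (some '' T)))) = T := by
    ext x; simp
  simp [link, addTriangle, Xor, this]

end Sets

variable {k : Type u} [Field k]

theorem eq_sum {E : Type u} [Fintype E] [DecidableEq E] (B : Set E → Prop)
    [DecidablePred fun T : Finset E => B (T : Set E)] :
    basisPoly k B = ∑ T ∈ Finset.univ.filter (fun T : Finset E => B (T : Set E)),
      ∏ e ∈ Tᶜ, MvPolynomial.X e := by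
  unfold basisPoly
  convert! rfl

variable {E : Type u} [Finite E]

theorem congr {B B' : Set E → Prop} (h : ∀ T, B T ↔ B' T) : basisPoly k B = basisPoly k B' := by
  rw [show B = B' from funext fun T => propext (h T)]

theorem of_forall_not {B : Set E → Prop} (h : ∀ T, ¬ B T) : basisPoly k B = 0 := by
  classical
  have := Fintype.ofFinite E
  simp [eq_sum, h]

theorem rename_equiv {E' : Type u} [Finite E'] (φ : E ≃ E') (B : Set E → Prop) (B' : Set E' → Prop)
    (h : ∀ T, B' (φ '' T) ↔ B T) :
    MvPolynomial.renameEquiv k φ (basisPoly k B) = basisPoly k B' := by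
  classical
  have := Fintype.ofFinite E
  have := Fintype.ofFinite E'
  rw [eq_sum, eq_sum, map_sum]
  refine Finset.sum_equiv φ.finsetCongr (fun T => ?_) (fun T _ => ?_)
  · simp [← h, Equiv.finsetCongr]
  · rw [map_prod]
    refine Finset.prod_equiv φ (fun e => ?_) (fun e _ => ?_)
    · simp [Equiv.finsetCongr]
    · simp

/-- Splitting off a variable: the sets avoiding it contribute the linear term, the sets
containing it the constant term. -/
theorem optionEquivLeft_eq (B : Set (Option E) → Prop) :
    MvPolynomial.optionEquivLeft k E (basisPoly k B) =
      Polynomial.C (basisPoly k (deletion B)) * Polynomial.X +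
        Polynomial.C (basisPoly k (link B)) := by
  classical
  have := Fintype.ofFinite E
  rw [eq_sum, eq_sum, eq_sum, ← Finset.sum_filter_add_sum_filter_not _ (fun T => none ∉ T),
    map_add, map_sum, map_sum, map_sum, map_sum, Finset.sum_mul]
  congr 1
  · refine (Finset.sum_nbij' (Finset.map Function.Embedding.some) Finset.eraseNone ?_ ?_ ?_ ?_ ?_).symm
    · intro T hT
      rw [Finset.mem_filter] at hT
      simpa [deletion] using hT.2
    · intro T
      simp only [Finset.mem_filter, Finset.mem_univ, true_and, and_imp]
      intro h h'
      simp only [deletion]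
      have : some '' (Finset.eraseNone T : Set E) = (T : Set (Option E)) := by
        ext (_ | x) <;> simp [h']
      rwa [this]
    · intro T _
      simp
    · intro T hT
      simp only [Finset.mem_filter] at hT
      ext (_ | x) <;> simp [hT.2]
    · intro T _
      have : (T.map Function.Embedding.some)ᶜ = Finset.insertNone Tᶜ := by
        ext (_ | x) <;> simp
      rw [this, Finset.prod_insertNone, map_mul, map_prod, map_prod]
      simp [mul_comm]
  · refine (Finset.sum_nbij' Finset.insertNone Finset.eraseNone ?_ ?_ ?_ ?_ ?_).symm
    · intro T
      have : (Finset.insertNone T : Set (Option E)) = insert none (some '' (T : Set E)) := by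
        ext (_ | x) <;> simp
      intro hT
      rw [Finset.mem_filter] at hT
      simpa [link, this] using hT.2
    · intro T
      simp only [Finset.mem_filter, Finset.mem_univ, true_and, and_imp, not_not]
      intro h h'
      simp only [link]
      have : insert none (some '' (Finset.eraseNone T : Set E)) = (T : Set (Option E)) := by
        ext (_ | x) <;> simp [h']
      rwa [this]
    · intro T _
      simp
    · intro T hT
      simp only [Finset.mem_filter, not_not] at hT
      ext (_ | x) <;> simp [hT.2]
    · intro T _
      have : (Finset.insertNone T)ᶜ = Tᶜ.map Function.Embedding.some := by
        ext (_ | x) <;> simp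
      rw [this, Finset.prod_map, map_prod, map_prod]
      simp

end basisPoly

/-! ### Recursion for the classes under building triangles. -/

namespace MotivicClass

open basisPoly
open Polynomial
open AlgVariety hiding X

variable (k : Type u) [Field k] {E : Type u} [Finite E]

/-- The class of the complement of the hypersurface of a basis generating polynomial. -/
noncomputable def basisCls (B : Set E → Prop) : K0Var k := openCls k (basisPoly k B)

variable {k}

theorem basisCls_equiv {E' : Type u} [Finite E'] (φ : E ≃ E') {B : Set E → Prop}
    {B' : Set E' → Prop} (h : ∀ T, B' (φ '' T) ↔ B T) : basisCls k B' = basisCls k B := by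
  rw [basisCls, ← basisPoly.rename_equiv φ B B' h, openCls_map]
  rfl

theorem basisCls_option (B : Set (Option E) → Prop) :
    basisCls k B =
      openCls k (C (basisPoly k (deletion B)) * X + C (basisPoly k (link B)) :
        (MvPolynomial E k)[X]) := by
  rw [basisCls, ← openCls_map (MvPolynomial.optionEquivLeft k E), basisPoly.optionEquivLeft_eq]

theorem optionEquivLeft_deletion_addTriangle (B : Set (Option E) → Prop) :
    MvPolynomial.optionEquivLeft k _ (basisPoly k (deletion (addTriangle B))) =
      C (basisPoly k B) := by
  rw [basisPoly.optionEquivLeft_eq,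
    basisPoly.of_forall_not (not_deletion_deletion_addTriangle B),
    basisPoly.congr (link_deletion_addTriangle B)]
  simp

/-- This is `Ψ t_q + t_e G`. The monomial `t_e` is written through the inverse of `optionEquivLeft`
because `e` is still among the variables of the coefficient ring. -/
theorem optionEquivLeft_link_addTriangle (B : Set (Option E) → Prop) :
    MvPolynomial.optionEquivLeft k _ (basisPoly k (link (addTriangle B))) =
      C (basisPoly k B) * X +
        C ((MvPolynomial.optionEquivLeft k E).symm (C (basisPoly k (link B)) * X)) := by
  rw [basisPoly.optionEquivLeft_eq, basisPoly.congr (deletion_link_addTriangle B),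
    basisPoly.congr (link_link_addTriangle B)]
  congr 2
  rw [AlgEquiv.eq_symm_apply, basisPoly.optionEquivLeft_eq]
  rw [basisPoly.congr (B' := link B) (by simp [link, deletion]), basisPoly.of_forall_not
      (B := link fun T => none ∉ T ∧ B (insert none T)) (by simp [link])]
  simp

theorem basisCls_deletion_addTriangle (B : Set (Option E) → Prop) :
    basisCls k (deletion (addTriangle B)) = lineClass k * basisCls k B := by
  rw [basisCls, ← openCls_map (MvPolynomial.optionEquivLeft k (Option E)),
    optionEquivLeft_deletion_addTriangle, openCls_C, basisCls]

/-- The class of the complement of the hypersurface after doubling the last edge. -/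
theorem basisCls_link_addTriangle (B : Set (Option E) → Prop) :
    basisCls k (link (addTriangle B)) = (torusClass k - 1) * basisCls k B
      + torusClass k * basisCls k (deletion B) + lineClass k * basisCls k (link B) := by
  have h := openCls_parallel (k := k) (basisPoly k (deletion B)) (basisPoly k (link B))
  rw [basisCls_option B]
  refine Eq.trans ?_ h
  rw [basisCls, ← openCls_map (MvPolynomial.optionEquivLeft k (Option E)),
    optionEquivLeft_link_addTriangle,
    -- The variable of `e` is split off from the coefficients too: it becomes the inner variable,
    -- the new rim edge being the outer one.
    ← openCls_map (A := (MvPolynomial (Option E) k)[X]) (B := (MvPolynomial E k)[X][X])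
      (Polynomial.mapAlgEquiv (MvPolynomial.optionEquivLeft k E))]
  congr 1
  have := basisPoly.optionEquivLeft_eq (k := k) B
  simp [this]

/-- The polynomial is linear in the new spoke with slope `Ψ`. In the linear formula the slope
contributes `𝕋𝕃[Ψ]` and the product term `-𝕃𝕋[Ψ]`; they cancel. -/
theorem basisCls_addTriangle (B : Set (Option E) → Prop) :
    basisCls k (addTriangle B) = lineClass k * basisCls k (link (addTriangle B)) := by
  have h := openCls_map (MvPolynomial.optionEquivLeft k (Option E))
    (basisPoly k (deletion (addTriangle B)) * basisPoly k (link (addTriangle B)))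
  rw [map_mul, optionEquivLeft_deletion_addTriangle, optionEquivLeft_link_addTriangle,
    openCls_C_mul_C_mul_X_add_C] at h
  rw [basisCls_option, openCls_C_mul_X_add_C, ← h]
  change torusClass k * basisCls k (deletion (addTriangle B)) +
    lineClass k * (basisCls k (link (addTriangle B)) - torusClass k * basisCls k B) = _
  rw [basisCls_deletion_addTriangle]
  ring

theorem basisCls_addTriangle_addTriangle (B : Set (Option E) → Prop) :
    basisCls k (addTriangle (addTriangle B)) =
      lineClass k * torusClass k * basisCls k (addTriangle B)
        + torusClass k * lineClass k ^ 2 * basisCls k B := by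
  rw [basisCls_addTriangle, basisCls_link_addTriangle, basisCls_deletion_addTriangle,
    basisCls_addTriangle B]
  ring

end MotivicClass

/-! ### Spanning forests as minimal spanning edge sets -/

namespace Graph

section Conn

variable {α : Type*} {β : Type*}

/-- The equivalence relation on vertices generated by the edges of `S`. -/
def conn (G : Graph α β) (S : Set β) : Setoid α :=
  Relation.EqvGen.setoid fun x y => ∃ f ∈ S, G.IsLink f x y

theorem conn_of_isLink {G : Graph α β} {S : Set β} {f : β} {x y : α} (hf : f ∈ S)
    (h : G.IsLink f x y) : G.conn S x y :=
  Relation.EqvGen.rel _ _ ⟨f, hf, h⟩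

theorem conn_le {G : Graph α β} {S : Set β} {r : Setoid α}
    (h : ∀ f ∈ S, ∀ x y, G.IsLink f x y → r x y) : G.conn S ≤ r :=
  Setoid.eqvGen_le fun x y ⟨f, hf, hl⟩ => h f hf x y hl

theorem conn_mono {G : Graph α β} {S S' : Set β} (h : S ⊆ S') : G.conn S ≤ G.conn S' :=
  conn_le fun _ hf _ _ hl => conn_of_isLink (h hf) hl

theorem conn_congr {G H : Graph α β} {S : Set β}
    (h : ∀ f ∈ S, ∀ x y, G.IsLink f x y ↔ H.IsLink f x y) : G.conn S = H.conn S :=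
  le_antisymm (conn_le fun f hf _ _ hl => conn_of_isLink hf ((h f hf _ _).1 hl))
    (conn_le fun f hf _ _ hl => conn_of_isLink hf ((h f hf _ _).2 hl))

theorem conn_insert_iff {G : Graph α β} {S : Set β} {f : β} {c d : α} (hf : G.IsLink f c d)
    {x y : α} : G.conn (insert f S) x y ↔
      G.conn S x y ∨ (G.conn S x c ∧ G.conn S d y) ∨ (G.conn S x d ∧ G.conn S c y) := by
  have ht : ∀ {u v w}, G.conn S u v → G.conn S v w → G.conn S u w := (G.conn S).trans'
  have hs : ∀ {u v}, G.conn S u v → G.conn S v u := (G.conn S).symm'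
  constructor
  · intro h
    induction h with
    | rel x y h =>
      obtain ⟨g, rfl | hg, hl⟩ := h
      · obtain ⟨rfl, rfl⟩ | ⟨rfl, rfl⟩ := hf.eq_and_eq_or_eq_and_eq hl
        · exact Or.inr (Or.inl ⟨(G.conn S).refl' _, (G.conn S).refl' _⟩)
        · exact Or.inr (Or.inr ⟨(G.conn S).refl' _, (G.conn S).refl' _⟩)
      · exact Or.inl (conn_of_isLink hg hl)
    | refl x => exact Or.inl ((G.conn S).refl' x)
    | symm x y _ ih =>
      obtain h | ⟨h, h'⟩ | ⟨h, h'⟩ := ih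
      · exact Or.inl (hs h)
      · exact Or.inr (Or.inr ⟨hs h', hs h⟩)
      · exact Or.inr (Or.inl ⟨hs h', hs h⟩)
    | trans x y z _ _ ih ih' =>
      obtain h | ⟨h, h'⟩ | ⟨h, h'⟩ := ih <;> obtain k | ⟨k, k'⟩ | ⟨k, k'⟩ := ih'
      · exact Or.inl (ht h k)
      · exact Or.inr (Or.inl ⟨ht h k, k'⟩)
      · exact Or.inr (Or.inr ⟨ht h k, k'⟩)
      · exact Or.inr (Or.inl ⟨h, ht h' k⟩)
      · exact Or.inr (Or.inl ⟨h, k'⟩)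
      · exact Or.inl (ht h k')
      · exact Or.inr (Or.inr ⟨h, ht h' k⟩)
      · exact Or.inl (ht h k')
      · exact Or.inr (Or.inr ⟨h, k'⟩)
  · have hm : ∀ {u v}, G.conn S u v → G.conn (insert f S) u v :=
      fun h => conn_mono (Set.subset_insert f S) h
    have hcd : G.conn (insert f S) c d := conn_of_isLink (Set.mem_insert f S) hf
    rintro (h | ⟨h, h'⟩ | ⟨h, h'⟩)
    · exact hm h
    · exact (G.conn _).trans' (hm h) ((G.conn _).trans' hcd (hm h'))
    · exact (G.conn _).trans' (hm h) ((G.conn _).trans' ((G.conn _).symm' hcd) (hm h'))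

theorem joined_iff_conn {G H : Graph α β} {S : Set β}
    (h : ∀ f x y, G.IsLink f x y ↔ f ∈ S ∧ H.IsLink f x y) {x y : α} :
    G.Joined x y ↔ H.conn S x y := by
  constructor
  · intro hj
    induction hj with
    | refl => exact (H.conn S).refl' x
    | tail _ hl ih =>
      obtain ⟨f, hl⟩ := hl
      exact (H.conn S).trans' ih (conn_of_isLink ((h _ _ _).1 hl).1 ((h _ _ _).1 hl).2)
  · intro hc
    induction hc with
    | rel x y hl =>
      obtain ⟨f, hf, hl⟩ := hl
      exact Relation.ReflTransGen.single ⟨f, (h _ _ _).2 ⟨hf, hl⟩⟩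
    | refl x => exact Relation.ReflTransGen.refl
    | symm x y _ ih =>
      have : Std.Symm G.Adj := ⟨fun _ _ huv => huv.symm⟩
      exact Relation.ReflTransGen.stdSymm.symm _ _ ih
    | trans x y z _ _ ih ih' => exact ih.trans ih'

theorem joined_restrict_iff {G : Graph α β} {S : Set β} {x y : α} :
    (G.restrict S).Joined x y ↔ G.conn S x y :=
  joined_iff_conn fun _ _ _ => by simp

theorem joined_iff {G : Graph α β} {x y : α} : G.Joined x y ↔ G.conn E(G) x y :=
  joined_iff_conn fun _ _ _ => ⟨fun h => ⟨h.edge_mem, h⟩, fun h => h.2⟩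

/-- The edges of `S` connect the ends of every edge of `G`. -/
def Spans (G : Graph α β) (S : Set β) : Prop := ∀ f x y, G.IsLink f x y → G.conn S x y

theorem Spans.le {G : Graph α β} {S : Set β} (h : G.Spans S) (S' : Set β) :
    G.conn S' ≤ G.conn S :=
  conn_le fun f _ x y hl => h f x y hl

theorem Spans.of_le {G : Graph α β} {S S' : Set β} (h : G.Spans S) (hS : G.conn S ≤ G.conn S') :
    G.Spans S' :=
  fun f x y hl => hS (h f x y hl)

/-- If `T` spans, then an edge of `T` is a bridge of the subgraph `T` exactly when `T` without it no
longer spans. Acyclicity thus becomes minimality, which is easier to carry through the graph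
operations. -/
theorem isSpanningForest_iff {G : Graph α β} {T : Set β} :
    G.IsSpanningForest T ↔ T ⊆ E(G) ∧ G.Spans T ∧ ∀ f ∈ T, ¬ G.Spans (T \ {f}) := by
  have hd : ∀ {f x y}, ((G.restrict T).deleteEdges {f}).Joined x y ↔ G.conn (T \ {f}) x y := by
    intro f x y
    refine joined_iff_conn fun g u v => ?_
    simp only [deleteEdges_isLink, restrict_isLink, Set.mem_sdiff]
    tauto
  simp only [IsSpanningForest, IsBridgeEdge, joined_restrict_iff, joined_iff (G := G), hd]
  refine and_congr_right fun hT => ?_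
  constructor
  · rintro ⟨h, h'⟩
    refine ⟨fun f x y hl => h' x y (conn_of_isLink hl.edge_mem hl), fun f hf hs => ?_⟩
    obtain ⟨-, x, y, hx, hy⟩ := h f hf
    exact hy (hs.le _ hx)
  · rintro ⟨h, h'⟩
    refine ⟨fun f hf => ⟨by simpa using ⟨hT hf, hf⟩, ?_⟩, fun x y hxy => h.le _ hxy⟩
    have := h' f hf
    simp only [Spans, not_forall] at this
    obtain ⟨g, x, y, hl, hn⟩ := this
    exact ⟨x, y, h g x y hl, hn⟩

/-! ### Deletion and contraction -/

/-- When the edges of `S` are added one by one, some `f` is the first to connect `a` with `b`. It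
lies on a cycle with `e`, so `e` can replace it. -/
theorem exists_exchange {G : Graph α β} {e : β} {a b : α} (he : G.IsLink e a b) (hab : a ≠ b)
    {S : Set β} (hfin : S.Finite) (hS : S ⊆ E(G)) (h : G.conn S a b) :
    ∃ f ∈ S, ∀ x y, G.IsLink f x y → G.conn (insert e (S \ {f})) x y := by
  induction S, hfin using Set.Finite.induction_on with
  | empty =>
    have : G.conn ∅ ≤ ⊥ := conn_le (by simp)
    exact absurd (this h) hab
  | @insert f S hf _ ih =>
    by_cases hc : G.conn S a b
    · obtain ⟨g, hg, hg'⟩ := ih ((Set.subset_insert _ _).trans hS) hc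
      refine ⟨g, Or.inr hg, fun x y hl => conn_mono ?_ (hg' x y hl)⟩
      exact Set.insert_subset_insert (Set.sdiff_subset_sdiff_left (Set.subset_insert f S))
    · refine ⟨f, Set.mem_insert f S, fun x y hl => ?_⟩
      rw [Set.insert_sdiff_of_mem _ (Set.mem_singleton _), Set.sdiff_singleton_eq_self hf, conn_insert_iff he]
      rw [conn_insert_iff hl] at h
      obtain h | ⟨h, h'⟩ | ⟨h, h'⟩ := h
      · exact absurd h hc
      · exact Or.inr (Or.inl ⟨(G.conn S).symm' h, (G.conn S).symm' h'⟩)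
      · exact Or.inr (Or.inr ⟨h', h⟩)

theorem isSpanningForest_deleteEdges_iff {G : Graph α β} {e : β} (he : e ∈ E(G))
    (hbridge : ¬ G.IsBridgeEdge e) {S : Set β} (hS : e ∉ S) :
    (G.deleteEdges {e}).IsSpanningForest S ↔ G.IsSpanningForest S := by
  have hconn : ∀ {S : Set β}, e ∉ S → (G.deleteEdges {e}).conn S = G.conn S := by
    intro S hS
    refine conn_congr fun f hf x y => ?_
    have : f ≠ e := by rintro rfl; exact hS hf
    simp [this]
  have hspans : ∀ {S : Set β}, e ∉ S → ((G.deleteEdges {e}).Spans S ↔ G.Spans S) := by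
    intro S hS
    constructor
    · intro h f x y hl
      have hj : (G.deleteEdges {e}).Joined x y := by
        -- This is where `e` not being a bridge enters: otherwise a set avoiding `e` could span `G ∖
        -- e` without joining the ends of `e`.
        by_contra hn
        exact hbridge ⟨he, x, y, Relation.ReflTransGen.single ⟨f, hl⟩, hn⟩
      rw [joined_iff] at hj
      rw [← hconn hS]
      exact h.le _ hj
    · intro h f x y hl
      rw [hconn hS]
      exact h f x y (by simp at hl; exact hl.1)
  rw [isSpanningForest_iff, isSpanningForest_iff, hspans hS]
  refine and_congr ?_ (and_congr_right fun _ => ?_)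
  · change S ⊆ E(G) \ {e} ↔ S ⊆ E(G)
    exact ⟨fun h => h.trans Set.sdiff_subset, fun h => Set.subset_sdiff_singleton h hS⟩
  · exact forall₂_congr fun f _ => not_congr (hspans fun h => hS h.1)

theorem conn_contractEdge_iff {G : Graph α β} {e : β} {S : Set β} (hS : e ∉ S) {x y : α} :
    (G.contractEdge e).conn S (Quot.mk _ x) (Quot.mk _ y) ↔ G.conn (insert e S) x y := by
  have hq : ∀ {x y}, Quot.mk (G.IsLink e) x = Quot.mk (G.IsLink e) y →
      G.conn (insert e S) x y := by
    intro x y h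
    have := Quot.eqvGen_exact h
    exact Relation.EqvGen.mono (fun u v huv => ⟨e, Set.mem_insert e S, huv⟩) _ _ this
  constructor
  · intro h
    suffices H : ∀ p q, (G.contractEdge e).conn S p q → ∀ x y, Quot.mk _ x = p → Quot.mk _ y = q →
        G.conn (insert e S) x y from H _ _ h x y rfl rfl
    intro p q h
    induction h with
    | rel p q h =>
      rintro x y rfl rfl
      obtain ⟨f, hf, u, v, hl, hu, hv⟩ := h
      simp only [deleteEdges_isLink] at hl
      exact (G.conn _).trans' (hq hu.symm)
        ((G.conn _).trans' (conn_of_isLink (Or.inr hf) hl.1) (hq hv))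
    | refl p =>
      rintro x y rfl h
      exact hq h.symm
    | symm p q _ ih =>
      intro x y hx hy
      exact (G.conn _).symm' (ih y x hy hx)
    | trans p q r _ _ ih ih' =>
      intro x y hx hy
      obtain ⟨z, hz⟩ := Quot.exists_rep q
      exact (G.conn _).trans' (ih x z hx hz) (ih' z y hz hy)
  · intro h
    have : G.conn (insert e S) ≤ ((G.contractEdge e).conn S).comap (Quot.mk _) := by
      refine conn_le ?_
      rintro f (rfl | hf) x y hl
      · rw [Setoid.comap_rel, Quot.sound hl]
      · rw [Setoid.comap_rel]
        refine conn_of_isLink hf ⟨x, y, ?_, rfl, rfl⟩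
        have : f ≠ e := by rintro rfl; exact hS hf
        simpa [this] using hl
    exact this h

theorem isSpanningForest_contractEdge_iff {G : Graph α β} {e : β} {a b : α} (he : G.IsLink e a b)
    (hab : a ≠ b) [Finite E(G)] {S : Set β} (hS : e ∉ S) :
    (G.contractEdge e).IsSpanningForest S ↔ G.IsSpanningForest (insert e S) := by
  have hspans : ∀ {S : Set β}, e ∉ S → ((G.contractEdge e).Spans S ↔ G.Spans (insert e S)) := by
    intro S hS
    constructor
    · intro h f x y hl
      rw [← conn_contractEdge_iff hS]
      by_cases hf : f = e
      · subst hf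
        rw [Quot.sound hl]
      · refine h f _ _ ⟨x, y, ?_, rfl, rfl⟩
        simpa [hf] using hl
    · rintro h f _ _ ⟨x, y, hl, rfl, rfl⟩
      rw [conn_contractEdge_iff hS]
      simp only [deleteEdges_isLink] at hl
      exact h f x y hl.1
  have hE : S ⊆ E(G.contractEdge e) ↔ insert e S ⊆ E(G) := by
    change S ⊆ E(G) \ {e} ↔ _
    rw [Set.insert_subset_iff]
    exact ⟨fun h => ⟨he.edge_mem, h.trans Set.sdiff_subset⟩,
      fun h => Set.subset_sdiff_singleton h.2 hS⟩
  have hins : ∀ {f}, f ∈ S → insert e S \ {f} = insert e (S \ {f}) := by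
    intro f hf
    refine Set.insert_sdiff_of_notMem _ ?_
    rintro rfl
    exact hS hf
  rw [isSpanningForest_iff, isSpanningForest_iff, hspans hS, hE]
  refine and_congr_right fun hsub => and_congr_right fun hsp => ?_
  constructor
  · intro h f hf hn
    have hmem : ∀ f ∈ S, ¬ G.Spans (insert e (S \ {f})) := fun f hf hn =>
      h f hf ((hspans fun h => hS h.1).2 hn)
    rcases hf with rfl | hf
    · rw [Set.insert_sdiff_of_mem _ (Set.mem_singleton _), Set.sdiff_singleton_eq_self hS] at hn
      -- If `S` spanned without `e`, then exchanging some `g ∈ S` for `e` would still span, against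
      -- the minimality of `S` in `G / e`.
      obtain ⟨g, hg, hg'⟩ := exists_exchange he hab ((Set.toFinite E(G)).subset
        ((Set.subset_insert _ _).trans hsub)) ((Set.subset_insert _ _).trans hsub)
        (hn _ _ _ he)
      refine hmem g hg (hn.of_le (conn_le fun f hf x y hl => ?_))
      by_cases hfg : f = g
      · exact hg' x y (hfg ▸ hl)
      · exact conn_of_isLink (Or.inr ⟨hf, hfg⟩) hl
    · rw [hins hf] at hn
      exact hmem f hf hn
  · intro h f hf hn
    refine h f (Or.inr hf) ?_
    rw [hins hf]
    exact (hspans fun h => hS h.1).1 hn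

end Conn

end Graph

/-! ### Building a triangle on an edge -/

namespace Graph

section Triangle

variable {α : Type*} {β : Type*}

/-- `H'` arises from `H` by building a triangle on the edge `e` with ends `a`, `c`: a new vertex `w`
is joined to `a` by `p` and to `c` by `q`. -/
structure IsTriangleExtension (H H' : Graph α β) (e p q : β) (a c w : α) : Prop where
  isLink : H.IsLink e a c
  isLink_iff : ∀ f ∈ E(H), ∀ x y, H'.IsLink f x y ↔ H.IsLink f x y
  edgeSet_eq : E(H') = insert p (insert q E(H))
  isLink_p : H'.IsLink p a w
  isLink_q : H'.IsLink q c w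
  p_notMem : p ∉ E(H)
  q_notMem : q ∉ E(H)
  p_ne_q : p ≠ q
  w_notMem : w ∉ V(H)

namespace IsTriangleExtension

variable {H H' : Graph α β} {e p q : β} {a c w : α}

theorem symm (h : IsTriangleExtension H H' e p q a c w) :
    IsTriangleExtension H H' e q p c a w where
  isLink := h.isLink.symm
  isLink_iff := h.isLink_iff
  edgeSet_eq := h.edgeSet_eq.trans (Set.insert_comm _ _ _)
  isLink_p := h.isLink_q
  isLink_q := h.isLink_p
  p_notMem := h.q_notMem
  q_notMem := h.p_notMem
  p_ne_q := h.p_ne_q.symm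
  w_notMem := h.w_notMem

theorem conn_eq (h : IsTriangleExtension H H' e p q a c w) {S : Set β} (hS : S ⊆ E(H)) :
    H'.conn S = H.conn S :=
  conn_congr fun f hf => h.isLink_iff f (hS hf)

theorem ne_of_isLink (h : IsTriangleExtension H H' e p q a c w) {f : β} {x y : α}
    (hl : H.IsLink f x y) : x ≠ w := by
  rintro rfl
  exact h.w_notMem hl.left_mem

/-- The new vertex is isolated in `H`, so its class is a singleton. -/
theorem eq_iff_of_conn (h : IsTriangleExtension H H' e p q a c w) {S : Set β} {x y : α}
    (hc : H.conn S x y) : x = w ↔ y = w := by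
  induction hc with
  | rel x y hl =>
    obtain ⟨f, -, hl⟩ := hl
    simp [h.ne_of_isLink hl, h.ne_of_isLink hl.symm]
  | refl => rfl
  | symm _ _ _ ih => exact ih.symm
  | trans _ _ _ _ _ ih ih' => exact ih.trans ih'

theorem not_spans (h : IsTriangleExtension H H' e p q a c w) {S : Set β} (hS : S ⊆ E(H)) :
    ¬ H'.Spans S := by
  intro hs
  have hc := hs p a w h.isLink_p
  rw [h.conn_eq hS] at hc
  exact h.ne_of_isLink h.isLink ((h.eq_iff_of_conn hc).2 rfl)

/-- The edge `p` is pendant at `w`: it attaches `w` to `a` and affects no other connection. -/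
theorem spans_insert_iff (h : IsTriangleExtension H H' e p q a c w) {S : Set β} (hS : S ⊆ E(H)) :
    H'.Spans (insert p S) ↔ H.Spans S := by
  constructor
  · intro hs f x y hl
    have hc := hs f x y ((h.isLink_iff f hl.edge_mem x y).2 hl)
    rw [conn_insert_iff h.isLink_p, h.conn_eq hS] at hc
    obtain hc | ⟨-, hc⟩ | ⟨hc, -⟩ := hc
    · exact hc
    · exact absurd ((h.eq_iff_of_conn hc).1 rfl) (h.ne_of_isLink hl.symm)
    · exact absurd ((h.eq_iff_of_conn hc).2 rfl) (h.ne_of_isLink hl)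
  · intro hs
    have hle : H.conn E(H) ≤ H'.conn (insert p S) := by
      refine (hs.le _).trans ?_
      rw [← h.conn_eq hS]
      exact conn_mono (Set.subset_insert p S)
    have hp : H'.conn (insert p S) a w := conn_of_isLink (Set.mem_insert p S) h.isLink_p
    have hq : H'.conn (insert p S) c w :=
      (H'.conn _).trans' (hle (conn_of_isLink h.isLink.edge_mem h.isLink.symm)) hp
    intro f x y hl
    have hf := hl.edge_mem
    rw [h.edgeSet_eq] at hf
    rcases hf with rfl | rfl | hf
    · exact conn_of_isLink (Set.mem_insert _ S) hl
    · obtain ⟨rfl, rfl⟩ | ⟨rfl, rfl⟩ := h.isLink_q.eq_and_eq_or_eq_and_eq hl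
      · exact hq
      · exact (H'.conn _).symm' hq
    · exact hle (conn_of_isLink hf ((h.isLink_iff f hf x y).1 hl))

/-- Any two sides of the triangle connect its three vertices, so `{p, q}` may be traded for `{p,
e}`, and then `p` is pendant. -/
theorem spans_insert_insert_iff (h : IsTriangleExtension H H' e p q a c w) {S : Set β}
    (hS : S ⊆ E(H)) : H'.Spans (insert p (insert q S)) ↔ H.Spans (insert e S) := by
  have he := h.isLink.edge_mem
  rw [← h.spans_insert_iff (Set.insert_subset he hS)]
  have he' : H'.IsLink e a c := (h.isLink_iff e he a c).2 h.isLink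
  have hc : H'.conn (insert p (insert q S)) = H'.conn (insert p (insert e S)) := by
    apply le_antisymm
    · have hp : H'.conn (insert p (insert e S)) a w :=
        conn_of_isLink (Set.mem_insert p _) h.isLink_p
      have hce : H'.conn (insert p (insert e S)) a c :=
        conn_of_isLink (Or.inr (Set.mem_insert e _)) he'
      have hq : H'.conn (insert p (insert e S)) c w := (H'.conn _).trans' ((H'.conn _).symm' hce) hp
      refine conn_le fun f hf x y hl => ?_
      rcases hf with rfl | rfl | hf
      · exact conn_of_isLink (Set.mem_insert _ _) hl
      · obtain ⟨rfl, rfl⟩ | ⟨rfl, rfl⟩ := h.isLink_q.eq_and_eq_or_eq_and_eq hl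
        · exact hq
        · exact (H'.conn _).symm' hq
      · exact conn_of_isLink (Or.inr (Or.inr hf)) hl
    · have hp : H'.conn (insert p (insert q S)) a w :=
        conn_of_isLink (Set.mem_insert p _) h.isLink_p
      have hq : H'.conn (insert p (insert q S)) c w :=
        conn_of_isLink (Or.inr (Set.mem_insert q _)) h.isLink_q
      have hce : H'.conn (insert p (insert q S)) a c := (H'.conn _).trans' hp ((H'.conn _).symm' hq)
      refine conn_le fun f hf x y hl => ?_
      rcases hf with rfl | rfl | hf
      · exact conn_of_isLink (Set.mem_insert _ _) hl
      · obtain ⟨rfl, rfl⟩ | ⟨rfl, rfl⟩ := he'.eq_and_eq_or_eq_and_eq hl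
        · exact hce
        · exact (H'.conn _).symm' hce
      · exact conn_of_isLink (Or.inr (Or.inr hf)) hl
  exact ⟨fun hs => hs.of_le hc.le, fun hs => hs.of_le hc.ge⟩

theorem not_isSpanningForest (h : IsTriangleExtension H H' e p q a c w) {S : Set β}
    (hS : S ⊆ E(H)) : ¬ H'.IsSpanningForest S := by
  rw [isSpanningForest_iff]
  exact fun hs => h.not_spans hS hs.2.1

theorem isSpanningForest_insert_iff (h : IsTriangleExtension H H' e p q a c w) {S : Set β}
    (hS : S ⊆ E(H)) : H'.IsSpanningForest (insert p S) ↔ H.IsSpanningForest S := by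
  have hp : p ∉ S := fun hp => h.p_notMem (hS hp)
  rw [isSpanningForest_iff, isSpanningForest_iff, h.spans_insert_iff hS]
  have hsub : insert p S ⊆ E(H') := by
    rw [h.edgeSet_eq]
    exact Set.insert_subset_insert (hS.trans (Set.subset_insert _ _))
  simp only [hsub, hS, true_and]
  refine and_congr_right fun _ => ?_
  have hins : ∀ f ∈ S, (H'.Spans (insert p S \ {f}) ↔ H.Spans (S \ {f})) := fun f hf => by
    rw [Set.insert_sdiff_of_notMem _ (by rintro rfl; exact hp hf),
      h.spans_insert_iff (Set.sdiff_subset.trans hS)]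
  constructor
  · exact fun hm f hf => (hins f hf).not.1 (hm f (Or.inr hf))
  · rintro hm f (rfl | hf)
    · rw [Set.insert_sdiff_of_mem _ (Set.mem_singleton _), Set.sdiff_singleton_eq_self hp]
      exact h.not_spans hS
    · exact (hins f hf).not.2 (hm f hf)

theorem isSpanningForest_insert_insert_iff (h : IsTriangleExtension H H' e p q a c w) {S : Set β}
    (hS : S ⊆ E(H)) :
    H'.IsSpanningForest (insert p (insert q S)) ↔ e ∉ S ∧ H.IsSpanningForest (insert e S) := by
  have hp : p ∉ insert q S := by
    rintro (hp | hp)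
    · exact h.p_ne_q hp
    · exact h.p_notMem (hS hp)
  have hq : q ∉ insert p S := by
    rintro (hq | hq)
    · exact h.p_ne_q hq.symm
    · exact h.q_notMem (hS hq)
  rw [isSpanningForest_iff, isSpanningForest_iff, h.spans_insert_insert_iff hS]
  have hsub : insert p (insert q S) ⊆ E(H') := by
    rw [h.edgeSet_eq]
    exact Set.insert_subset_insert (Set.insert_subset_insert hS)
  have hsub' : insert e S ⊆ E(H) := Set.insert_subset h.isLink.edge_mem hS
  have hins : ∀ f ∈ S,
      (H'.Spans (insert p (insert q S) \ {f}) ↔ H.Spans (insert e (S \ {f}))) := fun f hf => by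
    rw [Set.insert_sdiff_of_notMem _ (by rintro rfl; exact hp (Or.inr hf)),
      Set.insert_sdiff_of_notMem _ (by rintro rfl; exact hq (Or.inr hf)),
      h.spans_insert_insert_iff (Set.sdiff_subset.trans hS)]
  have hsp : H'.Spans (insert p (insert q S) \ {p}) ↔ H.Spans S := by
    rw [Set.insert_sdiff_of_mem _ (Set.mem_singleton _), Set.sdiff_singleton_eq_self hp,
      h.symm.spans_insert_iff hS]
  have hsq : H'.Spans (insert p (insert q S) \ {q}) ↔ H.Spans S := by
    rw [Set.insert_comm, Set.insert_sdiff_of_mem _ (Set.mem_singleton _),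
      Set.sdiff_singleton_eq_self hq, h.spans_insert_iff hS]
  simp only [hsub, hsub', true_and]
  constructor
  · rintro ⟨hs, hm⟩
    -- Without `p`, the edge `q` is pendant, so minimality at `p` says that `S` alone does not span;
    -- in particular `e ∉ S`.
    have hn : ¬ H.Spans S := hsp.not.1 (hm p (Set.mem_insert _ _))
    have he : e ∉ S := by
      intro he
      rw [Set.insert_eq_of_mem he] at hs
      exact hn hs
    refine ⟨he, hs, ?_⟩
    rintro f (rfl | hf)
    · rwa [Set.insert_sdiff_of_mem _ (Set.mem_singleton _), Set.sdiff_singleton_eq_self he]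
    · rw [Set.insert_sdiff_of_notMem _ (by rintro rfl; exact he hf)]
      exact (hins f hf).not.1 (hm f (Or.inr (Or.inr hf)))
  · rintro ⟨he, hs, hm⟩
    have hn : ¬ H.Spans S := by
      have := hm e (Set.mem_insert _ _)
      rwa [Set.insert_sdiff_of_mem _ (Set.mem_singleton _), Set.sdiff_singleton_eq_self he] at this
    refine ⟨hs, ?_⟩
    rintro f (rfl | rfl | hf)
    · exact hsp.not.2 hn
    · exact hsq.not.2 hn
    · have := hm f (Or.inr hf)
      rw [Set.insert_sdiff_of_notMem _ (by rintro rfl; exact he hf)] at this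
      exact (hins f hf).not.2 this

end IsTriangleExtension

end Triangle

/-! ### Labelled spanning forests -/

section Labelling

/-- `φ` labels the edges of `G` by `E`, and `B` is the family of spanning forests. -/
structure IsLabelling {α : Type v} {β E : Type u} (G : Graph α β) (φ : E → β)
    (B : Set E → Prop) : Prop where
  injective : Function.Injective φ
  range_eq : Set.range φ = E(G)
  isSpanningForest_iff : ∀ T, G.IsSpanningForest (φ '' T) ↔ B T

open MotivicClass basisPoly

theorem kirchhoff_eq_basisPoly {k : Type u} [Field k] {α : Type v} {β : Type u} (G : Graph α β)
    [Finite E(G)] :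
    G.kirchhoff k = basisPoly k fun T : Set E(G) => G.IsSpanningForest (Subtype.val '' T) := by
  unfold kirchhoff basisPoly
  congr! 2
  ext
  simp

theorem motivicU_eq_basisCls {k : Type u} [Field k] {α : Type v} {β : Type u} (G : Graph α β)
    [Finite E(G)] :
    G.motivicU k = basisCls k fun T : Set E(G) => G.IsSpanningForest (Subtype.val '' T) := by
  rw [basisCls, ← kirchhoff_eq_basisPoly]
  rfl

theorem IsLabelling.motivicU_eq {k : Type u} [Field k] {α : Type v} {β E : Type u} [Finite E]
    {G : Graph α β} [Finite E(G)] {φ : E → β} {B : Set E → Prop} (h : G.IsLabelling φ B) :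
    G.motivicU k = basisCls k B := by
  let ψ : E ≃ E(G) := (Equiv.ofInjective φ h.injective).trans (Equiv.setCongr h.range_eq)
  rw [motivicU_eq_basisCls]
  refine basisCls_equiv ψ fun T => ?_
  rw [← h.isSpanningForest_iff, Set.image_image]
  rfl

/-- The new spoke receives the label `none`, so it is the distinguished edge on which the next
triangle is built. -/
theorem IsLabelling.addTriangle {α : Type v} {β E : Type u} {H H' : Graph α β} {e p q : β}
    {a c w : α} (h : IsTriangleExtension H H' e p q a c w) {φ : Option E → β}
    {B : Set (Option E) → Prop} (hφ : H.IsLabelling φ B) (he : φ none = e) :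
    H'.IsLabelling (fun x => x.elim p fun x => x.elim q φ) (addTriangle B) where
  injective := by
    have hm : ∀ x, φ x ∈ E(H) := fun x => hφ.range_eq ▸ Set.mem_range_self x
    have hp : ∀ x, φ x ≠ p := fun x hx => h.p_notMem (hx ▸ hm x)
    have hq : ∀ x, φ x ≠ q := fun x hx => h.q_notMem (hx ▸ hm x)
    rintro (_ | _ | x) (_ | _ | y) hxy
    · rfl
    · exact absurd hxy h.p_ne_q
    · exact absurd hxy.symm (hp y)
    · exact absurd hxy.symm h.p_ne_q
    · rfl
    · exact absurd hxy.symm (hq y)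
    · exact absurd hxy (hp x)
    · exact absurd hxy (hq x)
    · exact congrArg (fun x => some (some x)) (hφ.injective hxy)
  range_eq := by
    rw [h.edgeSet_eq, ← hφ.range_eq]
    ext f
    simp [Option.exists, eq_comm]
  isSpanningForest_iff := by
    intro T
    set S : Set (Option E) := (fun x => some (some x)) ⁻¹' T with hST
    have hS : φ '' S ⊆ E(H) := hφ.range_eq ▸ Set.image_subset_range _ _
    have heS : e ∈ φ '' S ↔ some (some none) ∈ T := by
      rw [← he, hφ.injective.mem_set_image]
      rfl
    have heI : insert e (φ '' S) = φ '' insert none S := by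
      rw [Set.image_insert_eq, he]
    have himg : ∀ f, f ∈ (fun x : Option (Option (Option E)) => x.elim p fun x => x.elim q φ) '' T ↔
        (none ∈ T ∧ f = p) ∨ (some none ∈ T ∧ f = q) ∨ f ∈ φ '' S := by
      intro f
      simp [Option.exists, hST, eq_comm]
    by_cases hp : none ∈ T <;> by_cases hq : some none ∈ T
    · have : (fun x : Option (Option (Option E)) => x.elim p fun x => x.elim q φ) '' T =
          insert p (insert q (φ '' S)) := by
        ext f; rw [himg]; simp [hp, hq]
      rw [this, h.isSpanningForest_insert_insert_iff hS, heS, heI, hφ.isSpanningForest_iff]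
      simp [basisPoly.addTriangle, hp, hq, Xor, hST]
    · have : (fun x : Option (Option (Option E)) => x.elim p fun x => x.elim q φ) '' T =
          insert p (φ '' S) := by
        ext f; rw [himg]; simp [hp, hq]
      rw [this, h.isSpanningForest_insert_iff hS, hφ.isSpanningForest_iff]
      simp [basisPoly.addTriangle, hp, hq, Xor, hST]
    · have : (fun x : Option (Option (Option E)) => x.elim p fun x => x.elim q φ) '' T =
          insert q (φ '' S) := by
        ext f; rw [himg]; simp [hp, hq]
      rw [this, h.symm.isSpanningForest_insert_iff hS, hφ.isSpanningForest_iff]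
      simp [basisPoly.addTriangle, hp, hq, Xor, hST]
    · have : (fun x : Option (Option (Option E)) => x.elim p fun x => x.elim q φ) '' T =
          φ '' S := by
        ext f; rw [himg]; simp [hp, hq]
      rw [this]
      simp [basisPoly.addTriangle, hp, hq, Xor, h.not_isSpanningForest hS]

end Labelling

end Graph

/-! ### Lemonade graphs -/

namespace Graph

open MotivicClass basisPoly

section Lemonade

variable {α : Type v} {β : Type u} {G : Graph α β} {e : β} {a b : α}

theorem conn_lemonade_iff (he : G.IsLink e a b) (m : ℕ) (S : Set β) (x y : α) :
    (G.lemonade he m).conn (Sum.inl '' S) (Sum.inl x) (Sum.inl y) ↔ G.conn S x y := by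
  constructor
  · intro h
    -- The added vertices are related only to themselves by edges of `G`, whence the alternative `p
    -- = q`.
    suffices H : ∀ p q, (G.lemonade he m).conn (Sum.inl '' S) p q →
        p = q ∨ ∃ x y, p = Sum.inl x ∧ q = Sum.inl y ∧ G.conn S x y by
      obtain h | ⟨x', y', hx, hy, h⟩ := H _ _ h
      · rw [Sum.inl_injective h]
      · rwa [Sum.inl_injective hx, Sum.inl_injective hy]
    intro p q h
    induction h with
    | rel p q h =>
      obtain ⟨_, ⟨f, hf, rfl⟩, u, v, hl, hu, hv⟩ := h
      exact Or.inr ⟨u, v, hu, hv, conn_of_isLink hf hl⟩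
    | refl p => exact Or.inl rfl
    | symm p q _ ih =>
      obtain rfl | ⟨x, y, hx, hy, h⟩ := ih
      · exact Or.inl rfl
      · exact Or.inr ⟨y, x, hy, hx, (G.conn S).symm' h⟩
    | trans p q r _ _ ih ih' =>
      obtain rfl | ⟨x, y, rfl, rfl, h⟩ := ih
      · exact ih'
      · obtain rfl | ⟨y', z, hy, rfl, h'⟩ := ih'
        · exact Or.inr ⟨x, y, rfl, rfl, h⟩
        · obtain rfl := Sum.inl_injective hy
          exact Or.inr ⟨x, z, rfl, rfl, (G.conn S).trans' h h'⟩
  · intro h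
    have : G.conn S ≤ ((G.lemonade he m).conn (Sum.inl '' S)).comap Sum.inl :=
      conn_le fun f hf x y hl => conn_of_isLink ⟨f, hf, rfl⟩ ⟨x, y, hl, rfl, rfl⟩
    exact this h

theorem spans_lemonade_zero_iff (he : G.IsLink e a b) (S : Set β) :
    (G.lemonade he 0).Spans (Sum.inl '' S) ↔ G.Spans S := by
  constructor
  · intro h f x y hl
    exact (conn_lemonade_iff he 0 S x y).1 (h (Sum.inl f) _ _ ⟨x, y, hl, rfl, rfl⟩)
  · rintro h (f | f) x y hl
    · obtain ⟨u, v, hl, rfl, rfl⟩ := hl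
      exact (conn_lemonade_iff he 0 S u v).2 (h f u v hl)
    · exact absurd hl.1 (Nat.not_lt_zero _)

theorem isSpanningForest_lemonade_zero_iff (he : G.IsLink e a b) (S : Set β) :
    (G.lemonade he 0).IsSpanningForest (Sum.inl '' S) ↔ G.IsSpanningForest S := by
  have hE : E(G.lemonade he 0) = Sum.inl '' E(G) := by
    change Sum.inl '' E(G) ∪ Sum.inr '' {p : ℕ × Bool | p.1 < 0} = _
    simp
  rw [isSpanningForest_iff, isSpanningForest_iff, spans_lemonade_zero_iff, hE,
    Set.image_subset_image_iff Sum.inl_injective, Set.forall_mem_image]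
  refine and_congr_right fun _ => and_congr_right fun _ => forall₂_congr fun f _ => not_congr ?_
  rw [← Set.image_singleton, ← Set.image_sdiff Sum.inl_injective, spans_lemonade_zero_iff]

theorem IsLabelling.lemonade_zero {E : Type u} (he : G.IsLink e a b) {φ : E → β}
    {B : Set E → Prop} (h : G.IsLabelling φ B) :
    (G.lemonade he 0).IsLabelling (fun x => Sum.inl (φ x)) B where
  injective := Sum.inl_injective.comp h.injective
  range_eq := by
    change _ = Sum.inl '' E(G) ∪ Sum.inr '' {p : ℕ × Bool | p.1 < 0}
    rw [← h.range_eq, ← Set.range_comp]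
    simp [Function.comp_def]
  isSpanningForest_iff T := by
    rw [← h.isSpanningForest_iff, ← isSpanningForest_lemonade_zero_iff he, Set.image_image]

/-- The last spoke of the lemon. -/
def lastSpoke (e : β) : ℕ → β ⊕ ℕ × Bool
  | 0 => Sum.inl e
  | m + 1 => Sum.inr (m, true)

theorem isTriangleExtension_lemonade (he : G.IsLink e a b) (m : ℕ) :
    IsTriangleExtension (G.lemonade he m) (G.lemonade he (m + 1)) (lastSpoke e m)
      (Sum.inr (m, true)) (Sum.inr (m, false)) (Sum.inl a) (rimVertex b m) (Sum.inr m) where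
  isLink := by
    cases m with
    | zero => exact ⟨a, b, he, rfl, rfl⟩
    | succ m => exact ⟨Nat.lt_succ_self m, rfl⟩
  isLink_iff := by
    rintro (f | f) hf x y
    · rfl
    · have hf' : f.1 < m := by
        obtain ⟨_, _, h⟩ | ⟨_, hf, h⟩ := hf
        · cases h
        · exact Sum.inr_injective h ▸ hf
      exact and_congr_left fun _ => ⟨fun _ => hf', fun h => h.trans (Nat.lt_succ_self m)⟩
  edgeSet_eq := by
    change Sum.inl '' E(G) ∪ Sum.inr '' {p : ℕ × Bool | p.1 < m + 1} =
      insert _ (insert _ (Sum.inl '' E(G) ∪ Sum.inr '' {p : ℕ × Bool | p.1 < m}))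
    ext (f | ⟨i, _ | _⟩)
    · simp
    · simp [← le_iff_eq_or_lt]
    · simp [← le_iff_eq_or_lt]
  isLink_p := ⟨Nat.lt_succ_self m, rfl⟩
  isLink_q := ⟨Nat.lt_succ_self m, rfl⟩
  p_notMem := by
    rintro (⟨_, _, h⟩ | ⟨_, hf, h⟩)
    · cases h
    · cases h
      exact Nat.lt_irrefl m hf
  q_notMem := by
    rintro (⟨_, _, h⟩ | ⟨_, hf, h⟩)
    · cases h
    · cases h
      exact Nat.lt_irrefl m hf
  p_ne_q := by simp
  w_notMem := by
    rintro (⟨_, _, h⟩ | ⟨_, hf, h⟩)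
    · cases h
    · cases h
      exact Nat.lt_irrefl m hf

/-- The edges of `G` other than `e`, together with `e` as the last one. -/
theorem exists_isLabelling [Finite E(G)] (he : G.IsLink e a b)
    (hbridge : ¬ G.IsBridgeEdge e) (hab : a ≠ b) :
    ∃ (E : Type u) (_ : Finite E) (φ : Option E → β) (B : Set (Option E) → Prop),
      G.IsLabelling φ B ∧ φ none = e ∧
      (G.deleteEdges {e}).IsLabelling (fun x => φ (some x)) (deletion B) ∧
      (G.contractEdge e).IsLabelling (fun x => φ (some x)) (link B) := by
  refine ⟨E(G.deleteEdges {e}), inferInstance, fun x => x.elim e Subtype.val,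
    fun T => G.IsSpanningForest ((fun x => x.elim e Subtype.val) '' T), ⟨?_, ?_, fun _ => Iff.rfl⟩,
    rfl, ⟨Subtype.val_injective, Subtype.range_val, fun T => ?_⟩,
    ⟨Subtype.val_injective, Subtype.range_val, fun T => ?_⟩⟩
  · rintro (_ | x) (_ | y) h
    · rfl
    · exact absurd h.symm y.2.2
    · exact absurd h x.2.2
    · exact congrArg some (Subtype.val_injective h)
  · have : Set.range (fun x : Option E(G.deleteEdges {e}) => x.elim e Subtype.val) =
        insert e (E(G) \ {e}) := by
      ext f
      simp only [Set.mem_range, Option.exists, Option.elim_none, Option.elim_some,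
        Subtype.exists, exists_prop, exists_eq_right, Set.mem_insert_iff, eq_comm (a := f)]
      rfl
    rw [this, Set.insert_sdiff_singleton, Set.insert_eq_of_mem he.edge_mem]
  · have hT : e ∉ (fun x : E(G.deleteEdges {e}) => (x : β)) '' T := by
      rintro ⟨x, -, hx⟩
      exact x.2.2 hx
    refine (isSpanningForest_deleteEdges_iff he.edge_mem hbridge hT).trans ?_
    simp only [deletion, Set.image_image]
    rfl
  · have hT : e ∉ (fun x : E(G.deleteEdges {e}) => (x : β)) '' T := by
      rintro ⟨x, -, hx⟩
      exact x.2.2 hx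
    refine (isSpanningForest_contractEdge_iff he hab hT).trans ?_
    simp only [link, Set.image_insert_eq, Set.image_image]
    rfl

theorem exists_isLabelling_lemonade {E : Type u} [Finite E] (he : G.IsLink e a b)
    {φ : Option E → β} {B : Set (Option E) → Prop} (h : G.IsLabelling φ B) (hφ : φ none = e)
    (m : ℕ) :
    ∃ (E' : Type u) (_ : Finite E') (φ' : Option E' → β ⊕ ℕ × Bool) (B' : Set (Option E') → Prop),
      (G.lemonade he m).IsLabelling φ' B' ∧ φ' none = lastSpoke e m := by
  induction m with
  | zero => exact ⟨E, inferInstance, _, B, h.lemonade_zero he, congrArg Sum.inl hφ⟩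
  | succ m ih =>
    obtain ⟨E', _, φ', B', h', hφ'⟩ := ih
    exact ⟨_, inferInstance, _, _, h'.addTriangle (isTriangleExtension_lemonade he m) hφ', rfl⟩

variable {k : Type u} [Field k] [Finite E(G)]

theorem motivicU_lemonade_zero (he : G.IsLink e a b) (hbridge : ¬ G.IsBridgeEdge e)
    (hab : a ≠ b) : (G.lemonade he 0).motivicU k = G.motivicU k := by
  obtain ⟨E, _, φ, B, h, -, -, -⟩ := exists_isLabelling he hbridge hab
  rw [h.motivicU_eq, (h.lemonade_zero he).motivicU_eq]

theorem motivicU_lemonade_one (he : G.IsLink e a b) (hbridge : ¬ G.IsBridgeEdge e)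
    (hab : a ≠ b) : (G.lemonade he 1).motivicU k =
      lineClass k * ((torusClass k - 1) * G.motivicU k
        + torusClass k * (G.deleteEdges {e}).motivicU k
        + lineClass k * (G.contractEdge e).motivicU k) := by
  obtain ⟨E, _, φ, B, h, hφ, hd, hc⟩ := exists_isLabelling he hbridge hab
  have h1 := (h.lemonade_zero he).addTriangle (isTriangleExtension_lemonade he 0)
    (congrArg Sum.inl hφ)
  rw [h.motivicU_eq, hd.motivicU_eq, hc.motivicU_eq, h1.motivicU_eq, basisCls_addTriangle,
    basisCls_link_addTriangle]

theorem motivicU_lemonade_add_two (he : G.IsLink e a b) (hbridge : ¬ G.IsBridgeEdge e)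
    (hab : a ≠ b) (m : ℕ) : (G.lemonade he (m + 2)).motivicU k =
      lineClass k * torusClass k * (G.lemonade he (m + 1)).motivicU k
        + torusClass k * lineClass k ^ 2 * (G.lemonade he m).motivicU k := by
  obtain ⟨E, _, φ, B, h, hφ, -, -⟩ := exists_isLabelling he hbridge hab
  obtain ⟨E', _, φ', B', h', hφ'⟩ := exists_isLabelling_lemonade he h hφ m
  have h1 := h'.addTriangle (isTriangleExtension_lemonade he m) hφ'
  have h2 := h1.addTriangle (isTriangleExtension_lemonade he (m + 1)) rfl
  rw [h'.motivicU_eq, h1.motivicU_eq, h2.motivicU_eq, basisCls_addTriangle_addTriangle]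

end Lemonade

end Graph

/-! ### The generating series of the recursion. -/

theorem proposition5p12 {k : Type u} [Field k] {α : Type v} {β : Type u} (Γ : Graph α β)
    [Finite V(Γ)] [Finite E(Γ)] {e : β} {a b : α} (he : Γ.IsLink e a b)
    (hbridge : ¬ Γ.IsBridgeEdge e) (hloop : ¬ Γ.IsLoopingEdge e) :
    let 𝕋 : PowerSeries (K0Var k) := PowerSeries.C (torusClass k)
    let s : PowerSeries (K0Var k) := PowerSeries.X
    let D : PowerSeries (K0Var k) := 1 - 𝕋 * (𝕋 + 1) * s - 𝕋 * (𝕋 + 1) ^ 2 * s ^ 2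
    IsUnit D ∧
      PowerSeries.mk (fun m => (Γ.lemonade he m).motivicU k) * D =
        (1 - (𝕋 + 1) * s) * PowerSeries.C (Γ.motivicU k)
          + (𝕋 + 1) * 𝕋 * s * PowerSeries.C ((Γ.deleteEdges {e}).motivicU k)
          + (𝕋 + 1) ^ 2 * s * PowerSeries.C ((Γ.contractEdge e).motivicU k) := by
  intro 𝕋 s D
  have hab : a ≠ b := by
    rintro rfl
    exact hloop ⟨a, he⟩
  have h0 := Graph.motivicU_lemonade_zero (k := k) he hbridge hab
  have h1 := Graph.motivicU_lemonade_one (k := k) he hbridge hab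
  have h2 := Graph.motivicU_lemonade_add_two (k := k) he hbridge hab
  rw [MotivicClass.lineClass_eq] at h1
  simp only [MotivicClass.lineClass_eq] at h2
  refine ⟨PowerSeries.isUnit_iff_constantCoeff.2 (by simp [D, s]), ?_⟩
  set t := torusClass k
  set u : ℕ → K0Var k := fun m => (Γ.lemonade he m).motivicU k with hu
  have hD : D = 1 - PowerSeries.C (t * (t + 1)) * PowerSeries.X
      - PowerSeries.C (t * (t + 1) ^ 2) * PowerSeries.X ^ 2 := by
    simp [D, s, 𝕋, t]
  have hR : (1 - (𝕋 + 1) * s) * PowerSeries.C (Γ.motivicU k)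
          + (𝕋 + 1) * 𝕋 * s * PowerSeries.C ((Γ.deleteEdges {e}).motivicU k)
          + (𝕋 + 1) ^ 2 * s * PowerSeries.C ((Γ.contractEdge e).motivicU k) =
      PowerSeries.C (Γ.motivicU k) + PowerSeries.C (- (t + 1) * Γ.motivicU k
        + (t + 1) * t * (Γ.deleteEdges {e}).motivicU k
        + (t + 1) ^ 2 * (Γ.contractEdge e).motivicU k) * PowerSeries.X := by
    simp only [map_add, map_mul, map_neg, map_pow, map_one, s, 𝕋]
    ring
  have hL : PowerSeries.mk u * D = PowerSeries.mk u
      - PowerSeries.C (t * (t + 1)) * (PowerSeries.mk u * PowerSeries.X)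
      - PowerSeries.C (t * (t + 1) ^ 2) * (PowerSeries.mk u * PowerSeries.X ^ 2) := by
    rw [hD]
    ring
  rw [hR, hL]
  ext n
  -- Degrees 0 and 1 are the initial values; the numerator has no higher terms, so from degree 2 on
  -- the identity is the recursion.
  obtain _ | _ | n := n
  · simp [hu, h0]
  · simp only [map_add, map_sub, PowerSeries.coeff_C_mul, PowerSeries.coeff_succ_mul_X,
      PowerSeries.coeff_mk, PowerSeries.coeff_mul_X_pow', PowerSeries.coeff_C]
    simp [hu, h0, h1]
    ring
  · simp only [map_add, map_sub, PowerSeries.coeff_C_mul, PowerSeries.coeff_succ_mul_X,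
      PowerSeries.coeff_mk, PowerSeries.coeff_mul_X_pow', PowerSeries.coeff_C]
    simp [hu, h2]
    ring
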